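/- Consider germs at $+\infty$ of real-valued functions of a real variable (two functions are identified if they agree for all sufficiently large arguments). A Hardy field is a subfield of the ring of such germs that is closed under differentiation; let $\mathcal H$ be the union of all Hardy fields. Functions representing germs in $\mathcal H$ are taken to be defined on $[1,\infty)$, and we write $f\in\mathcal H$ for such a function. Write $f\prec g$ if $f(x)/g(x)\to 0$ as $x\to\infty$. For an integer $\ell\ge 0$, a function $f\in\mathcal H$ is said to be of type $x^{\ell+}$ if $x^\ell\prec f(x)\prec x^{\ell+1}$ and its growth exponent $\beta(f):=\inf\{c\in[0,\infty): f(x)\prec x^c\}$ is positive. Let $\chi(x)=1$ if the fractional part of $x$ lies in $[0,\tfrac12)$ and $\chi(x)=-1$ otherwise. For a function $f$ and an integer $N\ge1$ let $E_N=E_N(f)=(e_1,\dots,e_N)$ with $e_n=\chi(f(n))$. The well-distribution measure of $E_N$ is $$W(E_N)=\max_{a,b,M}\Bigl|\sum_{n=1}^{M}e_{an+b}\Bigr|,$$ where the maximum is over all integers $a\ge1$, $M\ge1$ and $b\in\mathbb Z$ with $1\le a+b\le aM+b\le N$. **Theorem.** Let $\ell\ge 0$ be an integer. If $f\in\mathcal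 H$ is of type $x^{\ell+}$, then there exists $\sigma=\sigma(f)>0$, depending only on $f$, such that for every $\varepsilon>0$ and all integers $N\ge1$ $$W(E_N)\ll N^{1-\sigma+\varepsilon},$$ where the implied constant may depend on $f$ and $\varepsilon$. -/

import Mathlib

open Filter Topology

noncomputable section

namespace HardyWD

/-- The ring `B` of germs at `+∞` of real functions of a real variable. -/
abbrev GermRing : Type := Germ (atTop : Filter ℝ) ℝ

/-- A Hardy field: a subring of `B` (with the same unit) that is a field and is closed under
differentiation, i.e. every function whose germ lies in it is eventually differentiable, and the
germ of its derivative lies in it again. -/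
structure IsHardyField (H : Subring GermRing) : Prop where
  isField : IsField H
  eventually_differentiableAt : ∀ f : ℝ → ℝ, (f : GermRing) ∈ H →
    ∀ᶠ x in atTop, DifferentiableAt ℝ f x
  deriv_mem : ∀ f : ℝ → ℝ, (f : GermRing) ∈ H → ((deriv f : ℝ → ℝ) : GermRing) ∈ H

/-- The union of all Hardy fields. -/
def hardyUnion : Set GermRing :=
  {φ | ∃ H : Subring GermRing, IsHardyField H ∧ φ ∈ H}

/-- `f ≺ g`: the quotient `f / g` is eventually defined and tends to `0` at `+∞`. -/
def Prec (f g : ℝ → ℝ) : Prop :=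
  (∀ᶠ x in atTop, g x ≠ 0) ∧ Tendsto (fun x => f x / g x) atTop (𝓝 0)

/-- The growth exponent `β(f) = inf {c ∈ [0, ∞) : f ≺ x ^ c}`. (It is only used for `f` that
satisfy `f ≺ x ^ (ℓ + 1)` for some natural number `ℓ`, where the set is not empty.) -/
def growthExponent (f : ℝ → ℝ) : ℝ :=
  sInf {c : ℝ | 0 ≤ c ∧ Prec f (fun x => x ^ c)}

/-- `f` is of type `x ^ {ℓ+}`. -/
structure IsOfType (f : ℝ → ℝ) (ℓ : ℕ) : Prop where
  lower : Prec (fun x => x ^ ℓ) f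
  upper : Prec f (fun x => x ^ (ℓ + 1))
  growthExponent_pos : 0 < growthExponent f

/-- `χ(x) = 1` if the fractional part of `x` is in `[0, 1/2)`, and `χ(x) = -1` otherwise. -/
def chi (x : ℝ) : ℤ := if Int.fract x < 1 / 2 then 1 else -1

/-- The binary sequence `e_n = χ(f(n))`; only the terms with `n ≥ 1` are ever used. -/
def binarySeq (f : ℝ → ℝ) (n : ℕ) : ℤ := chi (f n)

/-- `U(E, M, a, b) = ∑_{n=1}^M e_{an+b}`. The conversion `Int.toNat` does nothing for the
parameters admitted below, where `1 ≤ a n + b` for all `n ≥ 1`. -/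
def progSum (e : ℕ → ℤ) (M a : ℕ) (b : ℤ) : ℤ :=
  ∑ n ∈ Finset.Icc 1 M, e ((a : ℤ) * n + b).toNat

/-- The values `|U(E_N, M, a, b)|` over all positive integers `a`, `M` and all integers `b` with
`1 ≤ a + b ≤ a M + b ≤ N`. -/
def progSumValues (e : ℕ → ℤ) (N : ℕ) : Set ℕ :=
  {w | ∃ (a M : ℕ) (b : ℤ), 1 ≤ a ∧ 1 ≤ M ∧ 1 ≤ (a : ℤ) + b ∧ (a : ℤ) + b ≤ a * M + b ∧
    (a : ℤ) * M + b ≤ N ∧ w = (progSum e M a b).natAbs}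

/-- The well-distribution measure `W(E_N) = max |U(E_N, M, a, b)|` of `E_N = (e_1, …, e_N)`. -/
def wellDistribution (e : ℕ → ℤ) (N : ℕ) : ℕ := sSup (progSumValues e N)

/-- For a binary sequence and `N ≥ 1` the supremum is a maximum. -/
theorem isGreatest_wellDistribution (e : ℕ → ℤ) (he : ∀ n, (e n).natAbs = 1) {N : ℕ}
    (hN : 1 ≤ N) : IsGreatest (progSumValues e N) (wellDistribution e N) := by
  have hne : (progSumValues e N).Nonempty :=
    ⟨_, 1, 1, 0, le_rfl, le_rfl, by simp, by simp, by simpa using hN, rfl⟩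
  have hb : BddAbove (progSumValues e N) := by
    refine ⟨N, ?_⟩
    rintro w ⟨a, M, b, ha, hM, h1, -, h3, rfl⟩
    have hMN : M ≤ N := by
      have : (M : ℤ) ≤ N := by
        have ha' : (1 : ℤ) ≤ a := by exact_mod_cast ha
        have hM' : (1 : ℤ) ≤ M := by exact_mod_cast hM
        nlinarith [mul_nonneg (sub_nonneg.2 ha') (sub_nonneg.2 hM')]
      exact_mod_cast this
    have h : (progSum e M a b).natAbs ≤ M := by
      refine (Int.natAbs_sum_le _ _).trans ?_
      simp [he]
    exact h.trans hMN
  exact ⟨Nat.sSup_mem hne hb, fun w hw => le_csSup hb hw⟩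

end HardyWD

end

/-! Write β for the growth exponent of f. The proof finds a derivative of f of well-controlled size,
deduces a power saving for exponential sums of f along progressions, and transfers it to χ.

Size of derivatives. A function with germ in a Hardy field satisfies a dichotomy with respect to any
two powers (`IsHardyField.rpow_dichotomy`). With the mean value theorem this shows that the j-th
derivative is at most x^(β-j+o(1)). It is also at least that large: otherwise, integrating j times,
f would be a polynomial plus an error smaller than x^β by a power, which the type x^(ℓ+) and the
definition of β exclude. Hence some derivative of order at least two has constant sign and size
x^(-γ+o(1)) with 0 < γ < 2 (`exists_iterate_deriv_bounds`).

Exponential sums. For a, h at most a small power of N, and arguments not too close to the origin,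
the differences of h f(an+b) of that order are still N^(-γ) up to small powers of N. Van der Corput
differencing lowers the order to two. There the sum is cut where the first difference passes near an
integer, and the Kuzmin–Landau inequality handles the pieces (`norm_sum_le_of_difference_bounds`).

From exponential sums to χ. The function χ is a difference of two shifted sawtooths. The sawtooth is
controlled by difference quotients of the periodic Bernoulli function B₂, whose Fourier series
converges absolutely (`abs_sum_chi_le`). Progressions with large step, and the initial terms of the
others, have few terms and are bounded trivially. -/

namespace HardyWD

/-! ### Eventual behaviour of real functions -/

lemma eventually_mul_rpow_le (K : ℝ) {a b : ℝ} (hab : a < b) :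
    ∀ᶠ x : ℝ in atTop, K * x ^ a ≤ x ^ b := by
  filter_upwards [(tendsto_rpow_atTop (sub_pos.2 hab)).eventually_ge_atTop K,
    eventually_gt_atTop 0] with x hx h0
  calc K * x ^ a ≤ x ^ (b - a) * x ^ a := by gcongr
    _ = x ^ b := by rw [← Real.rpow_add h0]; ring_nf

lemma exists_monotoneOn_of_deriv_nonneg {g g' : ℝ → ℝ}
    (hd : ∀ᶠ x in atTop, HasDerivAt g (g' x) x) (hg : ∀ᶠ x in atTop, 0 ≤ g' x) :
    ∃ X : ℝ, 1 ≤ X ∧ MonotoneOn g (Set.Ici X) := by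
  obtain ⟨X, hX⟩ := eventually_atTop.1 (hd.and hg)
  refine ⟨max X 1, le_max_right _ _, monotoneOn_of_deriv_nonneg (convex_Ici _) ?_ ?_ ?_⟩
  · intro x hx
    exact (hX x ((le_max_left _ _).trans hx)).1.continuousAt.continuousWithinAt
  · intro x hx
    exact (hX x ((le_max_left _ _).trans (interior_subset hx))).1.differentiableAt.differentiableWithinAt
  · intro x hx
    obtain ⟨h1, h2⟩ := hX x ((le_max_left _ _).trans (interior_subset hx))
    rwa [h1.deriv]

lemma exists_antitoneOn_of_deriv_nonpos {g g' : ℝ → ℝ}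
    (hd : ∀ᶠ x in atTop, HasDerivAt g (g' x) x) (hg : ∀ᶠ x in atTop, g' x ≤ 0) :
    ∃ X : ℝ, 1 ≤ X ∧ AntitoneOn g (Set.Ici X) := by
  obtain ⟨X, h1, hX⟩ := exists_monotoneOn_of_deriv_nonneg (g := fun x => - g x)
    (g' := fun x => - g' x) (hd.mono fun x hx => hx.neg) (hg.mono fun x hx => by linarith)
  exact ⟨X, h1, fun x hx y hy hxy => by have := hX hx hy hxy; simp at this; exact this⟩

lemma eventually_nonneg_or_nonpos_of_monotoneOn {g : ℝ → ℝ} {X : ℝ}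
    (h : MonotoneOn g (Set.Ici X)) : (∀ᶠ x in atTop, 0 ≤ g x) ∨ ∀ᶠ x in atTop, g x ≤ 0 := by
  by_cases hx : ∃ x ≥ X, 0 ≤ g x
  · obtain ⟨x, hx, h0⟩ := hx
    left
    filter_upwards [eventually_ge_atTop x] with y hy
    exact h0.trans (h hx (hx.trans hy) hy)
  · push Not at hx
    right
    filter_upwards [eventually_ge_atTop X] with y hy
    exact (hx y hy).le

lemma eventually_pos_or_neg_of_ne_zero {g : ℝ → ℝ} (hc : ∀ᶠ x in atTop, ContinuousAt g x)
    (h0 : ∀ᶠ x in atTop, g x ≠ 0) : (∀ᶠ x in atTop, 0 < g x) ∨ ∀ᶠ x in atTop, g x < 0 := by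
  obtain ⟨X, hX⟩ := eventually_atTop.1 (hc.and h0)
  have hcont : ContinuousOn g (Set.Ici X) := fun x hx => (hX x hx).1.continuousWithinAt
  by_contra! hcon
  obtain ⟨h1, h2⟩ := hcon
  obtain ⟨y, hy, hy'⟩ := (h1.and_eventually (eventually_ge_atTop X)).exists
  obtain ⟨z, hz, hz'⟩ := (h2.and_eventually (eventually_ge_atTop X)).exists
  obtain ⟨w, hw, hw'⟩ := isPreconnected_Ici.intermediate_value hy' hz' hcont
    (Set.mem_Icc.2 ⟨hy, hz⟩)
  exact (hX w hw).2 hw'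

/-! ### Elements of Hardy fields -/

variable {H : Subring GermRing}

lemma IsHardyField.exists_inv (hH : IsHardyField H) {g : ℝ → ℝ} (hg : (g : GermRing) ∈ H)
    (h0 : ¬ ∀ᶠ x in atTop, g x = 0) :
    ∃ ψ : ℝ → ℝ, (ψ : GermRing) ∈ H ∧ ∀ᶠ x in atTop, g x * ψ x = 1 := by
  have hne : (⟨(g : GermRing), hg⟩ : H) ≠ 0 := by
    intro h
    have h' : (g : GermRing) = ((fun _ => (0 : ℝ) : ℝ → ℝ) : GermRing) := congrArg Subtype.val h
    exact h0 (Germ.coe_eq.1 h')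
  obtain ⟨⟨b, hb⟩, hgb⟩ := hH.isField.mul_inv_cancel hne
  induction b using Germ.inductionOn with
  | _ ψ =>
    refine ⟨ψ, hb, ?_⟩
    have h' : ((g * ψ : ℝ → ℝ) : GermRing) = ((fun _ => (1 : ℝ) : ℝ → ℝ) : GermRing) :=
      congrArg Subtype.val hgb
    exact Germ.coe_eq.1 h'

lemma IsHardyField.eventually_continuousAt (hH : IsHardyField H) {g : ℝ → ℝ}
    (hg : (g : GermRing) ∈ H) : ∀ᶠ x in atTop, ContinuousAt g x :=
  (hH.eventually_differentiableAt g hg).mono fun _ h => h.continuousAt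

/-- A non-zero germ is invertible, so the function eventually has no zeros; being eventually
continuous, it cannot change sign any more. -/
lemma IsHardyField.sign (hH : IsHardyField H) {g : ℝ → ℝ} (hg : (g : GermRing) ∈ H) :
    (∀ᶠ x in atTop, g x = 0) ∨ (∀ᶠ x in atTop, 0 < g x) ∨ ∀ᶠ x in atTop, g x < 0 := by
  by_cases h0 : ∀ᶠ x in atTop, g x = 0
  · exact Or.inl h0
  obtain ⟨ψ, -, hψ⟩ := hH.exists_inv hg h0
  exact Or.inr (eventually_pos_or_neg_of_ne_zero (hH.eventually_continuousAt hg)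
    (hψ.mono fun x hx h => by simp [h] at hx))

lemma IsHardyField.nonneg_or_nonpos (hH : IsHardyField H) {g : ℝ → ℝ}
    (hg : (g : GermRing) ∈ H) : (∀ᶠ x in atTop, 0 ≤ g x) ∨ ∀ᶠ x in atTop, g x ≤ 0 := by
  rcases hH.sign hg with h | h | h
  · exact Or.inl (h.mono fun x hx => hx.ge)
  · exact Or.inl (h.mono fun x hx => hx.le)
  · exact Or.inr (h.mono fun x hx => hx.le)

lemma IsHardyField.iterate_deriv_mem (hH : IsHardyField H) {g : ℝ → ℝ}
    (hg : (g : GermRing) ∈ H) (j : ℕ) : ((deriv^[j] g : ℝ → ℝ) : GermRing) ∈ H := by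
  induction j with
  | zero => exact hg
  | succ j ih => rw [Function.iterate_succ_apply']; exact hH.deriv_mem _ ih

/-- The sign of `x g' / g - m / n` is eventually constant. -/
lemma IsHardyField.sign_log_deriv_sub (hH : IsHardyField H) {g : ℝ → ℝ}
    (hg : (g : GermRing) ∈ H) (m : ℤ) {n : ℕ} :
    (∀ᶠ x in atTop, 0 ≤ g x * (n * x * deriv g x - m * g x)) ∨
      ∀ᶠ x in atTop, g x * (n * x * deriv g x - m * g x) ≤ 0 := by
  have hg' := hH.deriv_mem g hg
  by_cases h0 : ∀ᶠ x in atTop, deriv g x = 0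
  · rcases le_total m 0 with hm | hm
    · left
      filter_upwards [h0] with x hx
      have : (m : ℝ) ≤ 0 := by exact_mod_cast hm
      rw [hx]
      nlinarith [mul_self_nonneg (g x)]
    · right
      filter_upwards [h0] with x hx
      have : (0 : ℝ) ≤ m := by exact_mod_cast hm
      rw [hx]
      nlinarith [mul_self_nonneg (g x)]
  -- The germ of `x` need not lie in `H`, so the expression itself need not either. With `ψ = 1 /
  -- g'` it equals `g g' (n x - m g ψ)`. The last factor has derivative `n - m (g ψ)'`, whose germ
  -- does lie in `H`; so it is eventually monotone, hence of constant sign.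
  obtain ⟨ψ, hψ, hinv⟩ := hH.exists_inv hg' h0
  have hv : ((g * ψ : ℝ → ℝ) : GermRing) ∈ H := H.mul_mem hg hψ
  have hgg : ((g * deriv g : ℝ → ℝ) : GermRing) ∈ H := H.mul_mem hg hg'
  have hy' : (((fun _ => (n : ℝ)) - (fun _ => (m : ℝ)) * deriv (g * ψ) : ℝ → ℝ) : GermRing) ∈ H :=
    H.sub_mem (natCast_mem H n) (H.mul_mem (intCast_mem H m) (hH.deriv_mem _ hv))
  have hyd : ∀ᶠ x in atTop, HasDerivAt (fun x => n * x - m * (g * ψ) x)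
      (((fun _ => (n : ℝ)) - (fun _ => (m : ℝ)) * deriv (g * ψ) : ℝ → ℝ) x) x := by
    filter_upwards [hH.eventually_differentiableAt _ hv] with x hx
    exact (((hasDerivAt_id x).const_mul (n : ℝ)).sub
      (hx.hasDerivAt.const_mul (m : ℝ))).congr_deriv (by simp)
  have hy : (∀ᶠ x in atTop, 0 ≤ n * x - m * (g * ψ) x) ∨
      ∀ᶠ x in atTop, n * x - m * (g * ψ) x ≤ 0 := by
    rcases hH.nonneg_or_nonpos hy' with h | h
    · obtain ⟨X, -, hX⟩ := exists_monotoneOn_of_deriv_nonneg hyd h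
      exact eventually_nonneg_or_nonpos_of_monotoneOn hX
    · obtain ⟨X, -, hX⟩ := exists_antitoneOn_of_deriv_nonpos hyd h
      rcases eventually_nonneg_or_nonpos_of_monotoneOn hX.neg with h | h
      · exact Or.inr (h.mono fun x hx => by simpa using hx)
      · exact Or.inl (h.mono fun x hx => by simpa using hx)
  have key : ∀ᶠ x in atTop, g x * (n * x * deriv g x - m * g x) =
      (g * deriv g) x * (n * x - m * (g * ψ) x) := by
    filter_upwards [hinv] with x hx
    simp only [Pi.mul_apply]
    linear_combination (g x ^ 2 * m) * hx
  rcases hH.nonneg_or_nonpos hgg with h1 | h1 <;> rcases hy with h2 | h2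
  · left; filter_upwards [h1, h2, key] with x h1 h2 h; rw [h]; exact mul_nonneg h1 h2
  · right; filter_upwards [h1, h2, key] with x h1 h2 h
    rw [h]; exact mul_nonpos_of_nonneg_of_nonpos h1 h2
  · right; filter_upwards [h1, h2, key] with x h1 h2 h
    rw [h]; exact mul_nonpos_of_nonpos_of_nonneg h1 h2
  · left; filter_upwards [h1, h2, key] with x h1 h2 h
    rw [h]; exact mul_nonneg_of_nonpos_of_nonpos h1 h2

/-- An element of a Hardy field is comparable with powers of `x`. -/
lemma IsHardyField.rpow_dichotomy (hH : IsHardyField H) {g : ℝ → ℝ}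
    (hg : (g : GermRing) ∈ H) {c d : ℝ} (hcd : c < d) :
    (∀ᶠ x in atTop, |g x| ≤ x ^ d) ∨ ∀ᶠ x in atTop, x ^ c ≤ |g x| := by
  by_cases h0 : ∀ᶠ x in atTop, g x = 0
  · left
    filter_upwards [h0, eventually_ge_atTop 0] with x hx h
    rw [hx, abs_zero]; positivity
  have hne : ∀ᶠ x in atTop, g x ≠ 0 := by
    obtain ⟨ψ, -, hψ⟩ := hH.exists_inv hg h0
    exact hψ.mono fun x hx h => by simp [h] at hx
  -- `H` contains the integers but perhaps not all reals, hence a rational exponent. The derivative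
  -- of `g² x^(-2r)` is a positive multiple of the expression in `sign_log_deriv_sub`, so this
  -- function is eventually monotone and compares `|g|` with a multiple of `x^r`.
  obtain ⟨r, hcr, hrd⟩ := exists_rat_btwn hcd
  have hden : (0 : ℝ) < r.den := by exact_mod_cast r.den_pos
  have hr : (r : ℝ) * r.den = r.num := by exact_mod_cast Rat.mul_den_eq_num r
  have hder : ∀ᶠ x in atTop, HasDerivAt (fun x => g x ^ 2 * x ^ (-2 * (r : ℝ)))
      (2 / r.den * x ^ (-2 * (r : ℝ) - 1) * (g x * (r.den * x * deriv g x - r.num * g x))) x := by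
    filter_upwards [hH.eventually_differentiableAt g hg, eventually_gt_atTop 0] with x hx hx0
    have := (hx.hasDerivAt.pow 2).mul
      (Real.hasDerivAt_rpow_const (x := x) (p := -2 * (r : ℝ)) (Or.inl hx0.ne'))
    refine this.congr_deriv ?_
    have e : x ^ (-2 * (r : ℝ)) = x ^ (-2 * (r : ℝ) - 1) * x := by
      rw [← Real.rpow_add_one hx0.ne']; ring_nf
    rw [Pi.pow_apply, e, ← hr]
    push_cast
    field_simp
    ring
  have hsq : ∀ {x s : ℝ}, 0 < x → x ^ (2 * s) = (x ^ s) ^ 2 := by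
    intro x s hx
    rw [mul_comm, Real.rpow_mul hx.le]; norm_cast
  have hcan : ∀ {x : ℝ}, 0 < x → g x ^ 2 * x ^ (-2 * (r : ℝ)) * x ^ (2 * (r : ℝ)) = g x ^ 2 := by
    intro x hx
    rw [mul_assoc, ← Real.rpow_add hx]; simp
  rcases hH.sign_log_deriv_sub hg r.num (n := r.den) with hs | hs
  · right
    obtain ⟨X₀, h1, hX₀⟩ := exists_monotoneOn_of_deriv_nonneg hder (by
      filter_upwards [hs, eventually_gt_atTop 0] with x hx h0
      positivity)
    obtain ⟨X, hX, hXX⟩ := (hne.and (eventually_ge_atTop X₀)).exists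
    have hX0 : 0 < X := by linarith
    set K := g X ^ 2 * X ^ (-2 * (r : ℝ)) with hK
    have hKpos : 0 < K := by positivity
    filter_upwards [eventually_mul_rpow_le K⁻¹ (show 2 * c < 2 * r by linarith),
      eventually_ge_atTop X] with x hx hxX
    have hx0 : 0 < x := by linarith
    have hm := hX₀ hXX (hXX.trans hxX) hxX
    rw [← abs_of_nonneg (Real.rpow_nonneg hx0.le c), ← sq_le_sq]
    rw [← hsq hx0, ← hcan hx0]
    rw [inv_mul_le_iff₀ hKpos] at hx
    refine hx.trans ?_
    gcongr
  · left
    obtain ⟨X, h1, hX⟩ := exists_antitoneOn_of_deriv_nonpos hder (by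
      filter_upwards [hs, eventually_gt_atTop 0] with x hx h0
      exact mul_nonpos_of_nonneg_of_nonpos (by positivity) hx)
    filter_upwards [eventually_mul_rpow_le (g X ^ 2 * X ^ (-2 * (r : ℝ)))
      (show 2 * (r : ℝ) < 2 * d by linarith), eventually_ge_atTop X] with x hx hxX
    have hx0 : 0 < x := by linarith
    have hm := hX (Set.mem_Ici.2 le_rfl) hxX hxX
    refine abs_le_of_sq_le_sq ?_ (by positivity)
    rw [← hsq hx0, ← hcan hx0]
    refine le_trans ?_ hx
    gcongr

/-! ### Upper bounds for derivatives -/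

/-- Otherwise the dichotomy gives `|g'| ≥ x^c` with `c > a - 1`, and by the mean value theorem `g`
varies over `[x, 2x]` by more than its size allows. -/
lemma IsHardyField.abs_deriv_le (hH : IsHardyField H) {g : ℝ → ℝ} (hg : (g : GermRing) ∈ H)
    {a e : ℝ} (hga : ∀ᶠ x in atTop, |g x| ≤ x ^ a) (he : a - 1 < e) :
    ∀ᶠ x in atTop, |deriv g x| ≤ x ^ e := by
  obtain ⟨c, hc, hce⟩ := exists_between he
  refine (hH.rpow_dichotomy (hH.deriv_mem g hg) hce).resolve_right fun hlow => ?_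
  obtain ⟨X, hX⟩ := eventually_atTop.1
    ((hH.eventually_differentiableAt g hg).and (hlow.and hga))
  -- A lower bound for `(ξ / x)^c` with `x ≤ ξ ≤ 2x`, valid for either sign of `c`.
  have hm : 0 < min 1 ((2 : ℝ) ^ c) := by positivity
  obtain ⟨x, hx1, hxX, hx0⟩ := ((eventually_mul_rpow_le ((min 1 ((2 : ℝ) ^ c))⁻¹ * (2 + 2 ^ a))
    (show a < c + 1 by linarith)).and ((eventually_ge_atTop X).and
      (eventually_gt_atTop (0 : ℝ)))).exists
  have h2x : x < 2 * x := by linarith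
  obtain ⟨ξ, hξ, hξ'⟩ := exists_deriv_eq_slope g h2x
    (fun y hy => (hX y (hxX.trans hy.1)).1.continuousAt.continuousWithinAt)
    (fun y hy => (hX y (hxX.trans hy.1.le)).1.differentiableWithinAt)
  have h1 := (hX ξ (hxX.trans hξ.1.le)).2.1
  have hξc : min 1 ((2 : ℝ) ^ c) * x ^ c ≤ ξ ^ c := by
    rcases le_total 0 c with h | h
    · calc min 1 ((2 : ℝ) ^ c) * x ^ c ≤ 1 * x ^ c := by gcongr; exact min_le_left _ _
        _ ≤ ξ ^ c := by rw [one_mul]; exact Real.rpow_le_rpow hx0.le hξ.1.le h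
    · calc min 1 ((2 : ℝ) ^ c) * x ^ c ≤ 2 ^ c * x ^ c := by gcongr; exact min_le_right _ _
        _ = (2 * x) ^ c := by rw [Real.mul_rpow (by norm_num) hx0.le]
        _ ≤ ξ ^ c := Real.rpow_le_rpow_of_nonpos (hx0.trans hξ.1) hξ.2.le h
  have hup : |deriv g ξ| * x ≤ (1 + 2 ^ a) * x ^ a := by
    rw [hξ', show 2 * x - x = x by ring, abs_div, abs_of_pos hx0, div_mul_cancel₀ _ hx0.ne']
    have e1 := (hX x hxX).2.2
    have e2 := (hX (2 * x) (hxX.trans h2x.le)).2.2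
    rw [Real.mul_rpow (by norm_num) hx0.le] at e2
    linarith [abs_sub (g (2 * x)) (g x)]
  rw [mul_assoc, inv_mul_le_iff₀ hm, Real.rpow_add_one hx0.ne'] at hx1
  have hxa : 0 < x ^ a := by positivity
  have : min 1 ((2 : ℝ) ^ c) * x ^ c * x ≤ |deriv g ξ| * x := by
    gcongr; exact hξc.trans h1
  nlinarith

lemma IsHardyField.abs_iterate_deriv_le (hH : IsHardyField H) {g : ℝ → ℝ}
    (hg : (g : GermRing) ∈ H) {b : ℝ} (hgb : ∀ e, b < e → ∀ᶠ x in atTop, |g x| ≤ x ^ e)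
    (j : ℕ) : ∀ e, b - j < e → ∀ᶠ x in atTop, |deriv^[j] g x| ≤ x ^ e := by
  induction j with
  | zero => intro e he; exact hgb e (by simpa using he)
  | succ j ih =>
    intro e he
    push_cast at he
    rw [Function.iterate_succ_apply']
    exact hH.abs_deriv_le (hH.iterate_deriv_mem hg j)
      (ih ((b - j + (e + 1)) / 2) (by linarith)) (by linarith)

/-! ### Integration of power bounds -/

/-- With `w` the power primitive of `K x^c`, both `w + u` and `w - u` are eventually increasing; `c
= -1` would produce a logarithm. For `c < -1` the constant is the limit of `u`, obtained as the
supremum of `w + u`; for `c > -1` zero will do. -/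
lemma exists_abs_sub_const_le {u u' : ℝ → ℝ} {K c : ℝ} (hc : c ≠ -1)
    (hu : ∀ᶠ x in atTop, HasDerivAt u (u' x) x) (hb : ∀ᶠ x in atTop, |u' x| ≤ K * x ^ c) :
    ∃ A K' : ℝ, ∀ᶠ x in atTop, |u x - A| ≤ K' * x ^ (c + 1) := by
  have hc1 : c + 1 ≠ 0 := fun h => hc (by linarith)
  set w : ℝ → ℝ := fun x => K / (c + 1) * x ^ (c + 1) with hw
  have hwd : ∀ᶠ x in atTop, HasDerivAt w (K * x ^ c) x := by
    filter_upwards [eventually_gt_atTop 0] with x hx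
    refine ((Real.hasDerivAt_rpow_const (Or.inl hx.ne')).const_mul _).congr_deriv ?_
    rw [add_sub_cancel_right]
    field_simp
  obtain ⟨X, hX1, hX⟩ := exists_monotoneOn_of_deriv_nonneg (g := fun x => w x + u x)
    (g' := fun x => K * x ^ c + u' x)
    (by filter_upwards [hwd, hu] with x h1 h2 using h1.add h2)
    (by filter_upwards [hb] with x h; linarith [(abs_le.1 h).1])
  obtain ⟨Y, hY1, hY⟩ := exists_monotoneOn_of_deriv_nonneg (g := fun x => w x - u x)
    (g' := fun x => K * x ^ c - u' x)
    (by filter_upwards [hwd, hu] with x h1 h2 using h1.sub h2)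
    (by filter_upwards [hb] with x h; linarith [(abs_le.1 h).2])
  set Z := max X Y
  have hXZ : X ≤ Z := le_max_left _ _
  have hYZ : Y ≤ Z := le_max_right _ _
  have hZ1 : 1 ≤ Z := hX1.trans hXZ
  have hK : 0 ≤ K := by
    obtain ⟨x, hx, hx0⟩ := (hb.and (eventually_gt_atTop 0)).exists
    exact nonneg_of_mul_nonneg_left ((abs_nonneg _).trans hx) (Real.rpow_pos_of_pos hx0 c)
  rcases lt_or_gt_of_ne hc1 with hneg | hpos
  · have hw0 : ∀ x, Z ≤ x → w x ≤ 0 := fun x hx =>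
      mul_nonpos_of_nonpos_of_nonneg (div_nonpos_of_nonneg_of_nonpos hK hneg.le)
        (Real.rpow_nonneg (by linarith) _)
    have key : ∀ x y, Z ≤ x → Z ≤ y → w y + u y ≤ u x - w x := by
      intro x y hx hy
      have e1 := hX (hXZ.trans hy) (hXZ.trans (hy.trans (le_max_right x y))) (le_max_right x y)
      have e2 := hY (hYZ.trans hx) (hYZ.trans (hx.trans (le_max_left x y))) (le_max_left x y)
      have e3 := hw0 (max x y) (hx.trans (le_max_left x y))
      simp only at e1 e2
      linarith
    refine ⟨sSup ((fun y => w y + u y) '' Set.Ici Z), -(K / (c + 1)), ?_⟩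
    filter_upwards [eventually_ge_atTop Z] with x hx
    have e1 : w x + u x ≤ sSup ((fun y => w y + u y) '' Set.Ici Z) := by
      refine le_csSup ⟨u Z - w Z, ?_⟩ ⟨x, hx, rfl⟩
      rintro _ ⟨y, hy, rfl⟩
      exact key Z y le_rfl hy
    have e2 : sSup ((fun y => w y + u y) '' Set.Ici Z) ≤ u x - w x := by
      refine csSup_le ⟨_, ⟨x, hx, rfl⟩⟩ ?_
      rintro _ ⟨y, hy, rfl⟩
      exact key x y hx hy
    rw [neg_mul]
    change _ ≤ - w x
    rw [abs_le]
    constructor <;> linarith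
  · refine ⟨0, K / (c + 1) + (|w Z| + |u Z|), ?_⟩
    filter_upwards [eventually_ge_atTop Z] with x hx
    have e1 := hX hXZ (hXZ.trans hx) hx
    have e2 := hY hYZ (hYZ.trans hx) hx
    have e3 : 1 ≤ x ^ (c + 1) := Real.one_le_rpow (hZ1.trans hx) hpos.le
    have e4 : |w Z| + |u Z| ≤ (|w Z| + |u Z|) * x ^ (c + 1) :=
      le_mul_of_one_le_right (by positivity) e3
    rw [add_mul]
    change _ ≤ w x + _
    simp only at e1 e2
    rw [sub_zero, abs_le]
    constructor <;> linarith [neg_abs_le (w Z), neg_abs_le (u Z), le_abs_self (u Z)]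

lemma exists_polynomial_derivative_eq (P : Polynomial ℝ) :
    ∃ Q : Polynomial ℝ, Polynomial.derivative Q = P := by
  induction P using Polynomial.induction_on' with
  | add p q hp hq =>
    obtain ⟨p', rfl⟩ := hp
    obtain ⟨q', rfl⟩ := hq
    exact ⟨p' + q', by simp⟩
  | monomial n a =>
    refine ⟨Polynomial.monomial (n + 1) (a / (n + 1)), ?_⟩
    rw [Polynomial.derivative_monomial]
    congr 1
    push_cast
    field_simp

/-- Repeated integration: the integration constants build up the polynomial, and the condition on
`c` keeps every exponent met on the way different from `-1`. -/
lemma exists_polynomial_abs_sub_le {c K : ℝ} (k : ℕ) (hc : ∀ j : ℕ, c + j ≠ -1) :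
    ∀ g : ℝ → ℝ, (∀ j, ∀ᶠ x in atTop, DifferentiableAt ℝ (deriv^[j] g) x) →
      (∀ᶠ x in atTop, |deriv^[k] g x| ≤ K * x ^ c) →
      ∃ (P : Polynomial ℝ) (K' : ℝ), ∀ᶠ x in atTop, |g x - P.eval x| ≤ K' * x ^ (c + k) := by
  induction k with
  | zero => intro g _ hg; exact ⟨0, K, by simpa using hg⟩
  | succ k ih =>
    intro g hd hg
    obtain ⟨P, K', hP⟩ := ih (deriv g) (fun j => hd (j + 1)) hg
    obtain ⟨Q, rfl⟩ := exists_polynomial_derivative_eq P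
    obtain ⟨A, K'', hA⟩ := exists_abs_sub_const_le (u := fun x => g x - Q.eval x) (hc k)
      (by filter_upwards [hd 0] with x hx using hx.hasDerivAt.sub (Q.hasDerivAt x)) hP
    refine ⟨Q + Polynomial.C A, K'', ?_⟩
    filter_upwards [hA] with x hx
    rw [Polynomial.eval_add, Polynomial.eval_C, ← sub_sub]
    push_cast
    rwa [← add_assoc]

/-! ### The growth exponent -/

lemma eventually_abs_le_rpow_of_growthExponent_lt {f : ℝ → ℝ} {ℓ : ℕ} (hf : IsOfType f ℓ) {e : ℝ}
    (he : growthExponent f < e) : ∀ᶠ x in atTop, |f x| ≤ x ^ e := by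
  -- The infimum of the empty set would be 0; the upper bound in the type rules this out.
  have hne : {c : ℝ | 0 ≤ c ∧ Prec f (fun x => x ^ c)}.Nonempty := by
    refine ⟨(ℓ + 1 : ℕ), by positivity, ?_⟩
    simpa only [Real.rpow_natCast] using hf.upper
  obtain ⟨c, ⟨-, hc⟩, hce⟩ := exists_lt_of_csInf_lt hne he
  filter_upwards [hc.2.eventually (Metric.ball_mem_nhds 0 one_pos), eventually_ge_atTop 1]
    with x hx h1
  have hxc : 0 < x ^ c := by positivity
  rw [dist_zero_right, Real.norm_eq_abs, abs_div, abs_of_pos hxc,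
    div_lt_one hxc] at hx
  exact hx.le.trans (Real.rpow_le_rpow_of_exponent_le h1 hce.le)

lemma growthExponent_le {f : ℝ → ℝ} {e K : ℝ} (he : 0 ≤ e)
    (h : ∀ᶠ x in atTop, |f x| ≤ K * x ^ e) : growthExponent f ≤ e := by
  refine le_of_forall_gt_imp_ge_of_dense fun d hd => ?_
  refine csInf_le ⟨0, fun _ h => h.1⟩ ⟨he.trans hd.le, ?_, ?_⟩
  · filter_upwards [eventually_gt_atTop 0] with x hx using (Real.rpow_pos_of_pos hx d).ne'
  · have h0 : Tendsto (fun x : ℝ => K * x ^ (-(d - e))) atTop (𝓝 0) := by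
      simpa using (tendsto_rpow_neg_atTop (sub_pos.2 hd)).const_mul K
    refine squeeze_zero_norm' ?_ h0
    filter_upwards [h, eventually_gt_atTop 0] with x hx h0
    have hxd : 0 < x ^ d := by positivity
    rw [Real.norm_eq_abs, abs_div, abs_of_pos hxd, div_le_iff₀ hxd, mul_assoc,
      ← Real.rpow_add h0]
    simpa using hx

/-- For `m > ℓ` the quotient tends to 0 because `f ≺ x^(ℓ+1)`; for `m ≤ ℓ` it cannot have a finite
limit because `x^ℓ ≺ f`. -/
lemma IsOfType.not_tendsto_div_pow {f : ℝ → ℝ} {ℓ : ℕ} (hf : IsOfType f ℓ) {a : ℝ} (ha : a ≠ 0)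
    (m : ℕ) : ¬ Tendsto (fun x => f x / x ^ m) atTop (𝓝 a) := by
  intro h
  rcases Nat.lt_or_ge ℓ m with hm | hm
  · refine ha (tendsto_nhds_unique h ?_)
    refine squeeze_zero_norm' ?_ (by simpa using hf.upper.2.norm)
    filter_upwards [eventually_ge_atTop 1] with x hx
    have hx0 : 0 < x := by linarith
    rw [Real.norm_eq_abs, abs_div, abs_of_pos (pow_pos hx0 m), abs_of_pos hx0]
    gcongr
    exact hm
  · have h0 := hf.lower.2.mul h
    rw [zero_mul] at h0
    have := h0.eventually (gt_mem_nhds one_pos)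
    obtain ⟨x, hx, hfx, h1⟩ := (this.and (hf.lower.1.and (eventually_ge_atTop 1))).exists
    have hx0 : 0 < x := by linarith
    rw [div_mul_div_comm, mul_comm (f x), mul_div_mul_right _ _ hfx, div_lt_one (by positivity)] at hx
    exact absurd (pow_le_pow_right₀ h1 hm) (not_le.2 hx)

/-- If the bound fails, the dichotomy and integration give `f = P + O(x^e)` with a polynomial `P`
and `e < β`. When `deg P ≤ e` this contradicts the definition of β; when `deg P > e`, `f` is
asymptotic to a monomial, which the type forbids. -/
lemma IsHardyField.rpow_le_abs_iterate_deriv (hH : IsHardyField H) {f : ℝ → ℝ}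
    (hf : (f : GermRing) ∈ H) {ℓ : ℕ} (ht : IsOfType f ℓ) (k : ℕ) {ε : ℝ} (hε : 0 < ε) :
    ∀ᶠ x in atTop, x ^ (growthExponent f - k - ε) ≤ |deriv^[k] f x| := by
  set β := growthExponent f with hβ
  have hβ0 : 0 < β := ht.growthExponent_pos
  have hceil : ((⌈β⌉ : ℤ) : ℝ) - 1 < β := by linarith [Int.ceil_lt_add_one β]
  -- Lying strictly between `⌈β⌉ - 1` and `β`, the exponent `e` is positive and not an integer, so
  -- the integrations never meet the exponent `-1`.
  obtain ⟨e, he, heβ⟩ := exists_between (max_lt hceil (show β - ε < β by linarith))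
  have he1 : ((⌈β⌉ : ℤ) : ℝ) - 1 < e := (le_max_left _ _).trans_lt he
  have he2 : β - ε < e := (le_max_right _ _).trans_lt he
  have he0 : 0 < e := by
    have : (1 : ℝ) ≤ ((⌈β⌉ : ℤ) : ℝ) := by exact_mod_cast Int.ceil_pos.2 hβ0
    linarith
  refine (hH.rpow_dichotomy (hH.iterate_deriv_mem hf k)
    (show β - k - ε < e - k by linarith)).resolve_left fun hup => ?_
  obtain ⟨P, K, hP⟩ := exists_polynomial_abs_sub_le (c := e - k) (K := 1) k (by
    intro j hj
    have hi : e = ((k - j - 1 : ℤ) : ℝ) := by push_cast; linarith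
    rw [hi] at he1 heβ
    have h1 : ⌈β⌉ - 1 < (k - j - 1 : ℤ) := by exact_mod_cast he1
    have h2 : (k - j - 1 : ℤ) < ⌈β⌉ := Int.lt_ceil.2 heβ
    omega) f (fun j => hH.eventually_differentiableAt _ (hH.iterate_deriv_mem hf j))
    (by simpa using hup)
  rw [sub_add_cancel] at hP
  rcases le_or_gt (P.natDegree : ℝ) e with hm | hm
  · have hO := Polynomial.isBigO_atTop_of_degree_le P (Polynomial.X ^ P.natDegree)
      (by rw [Polynomial.degree_X_pow]; exact Polynomial.degree_le_natDegree)
    obtain ⟨C, hC⟩ := hO.bound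
    refine absurd (growthExponent_le (K := K + |C|) he0.le ?_) (not_le.2 heβ)
    filter_upwards [hP, hC, eventually_ge_atTop 1] with x h1 h2 hx
    have hx0 : 0 < x := by linarith
    rw [Polynomial.eval_pow, Polynomial.eval_X, Real.norm_eq_abs, Real.norm_eq_abs,
      abs_of_pos (pow_pos hx0 _), ← Real.rpow_natCast] at h2
    have h3 : x ^ (P.natDegree : ℝ) ≤ x ^ e := Real.rpow_le_rpow_of_exponent_le hx hm
    have h4 : C * x ^ (P.natDegree : ℝ) ≤ |C| * x ^ e := by gcongr; exact le_abs_self C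
    have := abs_sub_abs_le_abs_sub (f x) (P.eval x)
    linarith
  · have hP0 : P ≠ 0 := by
      rintro rfl
      simp at hm; linarith
    refine ht.not_tendsto_div_pow (Polynomial.leadingCoeff_ne_zero.2 hP0) P.natDegree ?_
    have h1 := Polynomial.div_tendsto_atTop_leadingCoeff_div_of_degree_eq P (Polynomial.X ^ P.natDegree)
      (by rw [Polynomial.degree_X_pow, Polynomial.degree_eq_natDegree hP0])
    simp only [Polynomial.eval_pow, Polynomial.eval_X, Polynomial.leadingCoeff_X_pow,
      div_one] at h1
    have h2 : Tendsto (fun x => (f x - P.eval x) / x ^ P.natDegree) atTop (𝓝 0) := by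
      have h0 : Tendsto (fun x : ℝ => K * x ^ (-(P.natDegree - e))) atTop (𝓝 0) := by
        simpa using (tendsto_rpow_neg_atTop (sub_pos.2 hm)).const_mul K
      refine squeeze_zero_norm' ?_ h0
      filter_upwards [hP, eventually_gt_atTop 0] with x hx h0
      have hxd : 0 < x ^ P.natDegree := by positivity
      rw [Real.norm_eq_abs, abs_div, abs_of_pos hxd, div_le_iff₀ hxd, ← Real.rpow_natCast,
        mul_assoc, ← Real.rpow_add h0]
      simpa using hx
    have h3 := h2.add h1
    rw [zero_add] at h3
    refine h3.congr fun x => ?_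
    rw [← add_div, sub_add_cancel]

/-- Some derivative of a function of type `x ^ {ℓ+}`, of order at least two, has order of magnitude
`x ^ (-γ)` up to factors `x ^ o(1)` for some `γ` strictly between `0` and `2`. -/
theorem exists_iterate_deriv_bounds {f : ℝ → ℝ} (hf : (f : GermRing) ∈ hardyUnion) {ℓ : ℕ}
    (ht : IsOfType f ℓ) :
    ∃ (k : ℕ) (γ : ℝ), 0 < γ ∧ γ < 2 ∧
      (∀ j, ∀ᶠ x in atTop, DifferentiableAt ℝ (deriv^[j] f) x) ∧
      ((∀ᶠ x in atTop, 0 < deriv^[k + 2] f x) ∨ ∀ᶠ x in atTop, deriv^[k + 2] f x < 0) ∧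
      ∀ ε : ℝ, 0 < ε → ∀ᶠ x in atTop,
        x ^ (-γ - ε) ≤ |deriv^[k + 2] f x| ∧ |deriv^[k + 2] f x| ≤ x ^ (-γ + ε) := by
  obtain ⟨H, hH, hf⟩ := hf
  set β := growthExponent f with hβ
  have hβ0 : 0 < β := ht.growthExponent_pos
  have hd : ∀ j, ∀ᶠ x in atTop, DifferentiableAt ℝ (deriv^[j] f) x := fun j =>
    hH.eventually_differentiableAt _ (hH.iterate_deriv_mem hf j)
  have hlow := fun k ε => hH.rpow_le_abs_iterate_deriv hf ht k (ε := ε)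
  obtain ⟨k, hk0, hk2⟩ : ∃ k : ℕ, 0 < (k + 2 : ℕ) - β ∧ (k + 2 : ℕ) - β < 2 := by
    -- The subtraction is truncated: for `⌊β⌋ = 0` the order is two and `γ = 2 - β`, below 2 because
    -- `β > 0`; otherwise the order is `⌊β⌋ + 1` and `γ ≤ 1`.
    refine ⟨⌊β⌋₊ - 1, ?_, ?_⟩
    · have h1 := Nat.lt_floor_add_one β
      have h2 : ((⌊β⌋₊ + 1 : ℕ) : ℝ) ≤ (⌊β⌋₊ - 1 + 2 : ℕ) := by exact_mod_cast by omega
      push_cast at h1 h2 ⊢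
      linarith
    · rcases Nat.eq_zero_or_pos ⌊β⌋₊ with h | h
      · rw [h]; simp [hβ0]
      · have h1 := Nat.floor_le hβ0.le
        have h2 : ⌊β⌋₊ - 1 + 2 = ⌊β⌋₊ + 1 := by omega
        rw [h2]
        push_cast
        linarith
  refine ⟨k, (k + 2 : ℕ) - β, hk0, hk2, hd, ?_, fun ε hε => ?_⟩
  · refine eventually_pos_or_neg_of_ne_zero ((hd _).mono fun x hx => hx.continuousAt) ?_
    filter_upwards [hlow (k + 2) 1 one_pos, eventually_gt_atTop 0] with x hx h0 h
    rw [h, abs_zero] at hx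
    exact absurd (Real.rpow_pos_of_pos h0 _) (not_lt.2 hx)
  · filter_upwards [hlow (k + 2) ε hε, hH.abs_iterate_deriv_le hf
      (fun e he => eventually_abs_le_rpow_of_growthExponent_lt ht he) (k + 2)
      (-((k + 2 : ℕ) - β) + ε) (by linarith)] with x h1 h2
    exact ⟨by rw [neg_sub]; exact h1, h2⟩

/-! ### Exponential sums -/

/-- `e(x) = exp (2 π i x)`. -/
noncomputable def expTwoPi (x : ℝ) : ℂ := Complex.exp ((2 * Real.pi * x : ℝ) * Complex.I)

lemma norm_expTwoPi (x : ℝ) : ‖expTwoPi x‖ = 1 := Complex.norm_exp_ofReal_mul_I _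

lemma expTwoPi_add (x y : ℝ) : expTwoPi (x + y) = expTwoPi x * expTwoPi y := by
  rw [expTwoPi, expTwoPi, expTwoPi, ← Complex.exp_add]
  congr 1; push_cast; ring

lemma expTwoPi_intCast (n : ℤ) : expTwoPi n = 1 := by
  rw [expTwoPi, Complex.exp_eq_one_iff]
  exact ⟨n, by push_cast; ring⟩

lemma conj_expTwoPi (x : ℝ) : (starRingEnd ℂ) (expTwoPi x) = expTwoPi (-x) := by
  rw [expTwoPi, expTwoPi, ← Complex.exp_conj]
  congr 1
  rw [map_mul, Complex.conj_ofReal, Complex.conj_I]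
  push_cast; ring

lemma re_expTwoPi (x : ℝ) : (expTwoPi x).re = Real.cos (2 * Real.pi * x) := by
  rw [expTwoPi, Complex.exp_ofReal_mul_I_re]

lemma norm_sum_expTwoPi_neg {ι : Type*} (s : Finset ι) (u : ι → ℝ) :
    ‖∑ n ∈ s, expTwoPi (-u n)‖ = ‖∑ n ∈ s, expTwoPi (u n)‖ := by
  simp_rw [← conj_expTwoPi]
  rw [← map_sum, RCLike.norm_conj]

lemma norm_sum_expTwoPi_le {ι : Type*} (s : Finset ι) (u : ι → ℝ) :
    ‖∑ n ∈ s, expTwoPi (u n)‖ ≤ s.card := by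
  refine (norm_sum_le _ _).trans ?_
  simp [norm_expTwoPi]

/-- `cot (π t)`. -/
noncomputable def cotPi (t : ℝ) : ℝ := Real.cos (Real.pi * t) / Real.sin (Real.pi * t)

lemma two_mul_le_sin_pi_mul {θ t : ℝ} (hθ : 0 < θ) (h1 : θ ≤ t) (h2 : t ≤ 1 - θ) :
    2 * θ ≤ Real.sin (Real.pi * t) := by
  have aux : ∀ s, θ ≤ s → s ≤ 1 / 2 → 2 * θ ≤ Real.sin (Real.pi * s) := by
    intro s hs hs'
    have := Real.mul_le_sin (x := Real.pi * s) (by have := Real.pi_pos; nlinarith)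
      (by have := Real.pi_pos; nlinarith)
    have e : 2 / Real.pi * (Real.pi * s) = 2 * s := by field_simp
    linarith
  rcases le_total t (1 / 2) with h | h
  · exact aux t h1 h
  · have := aux (1 - t) (by linarith) (by linarith)
    rwa [mul_sub, mul_one, Real.sin_pi_sub] at this

lemma abs_cotPi_le {θ t : ℝ} (hθ : 0 < θ) (h1 : θ ≤ t) (h2 : t ≤ 1 - θ) :
    |cotPi t| ≤ 1 / (2 * θ) := by
  have h := two_mul_le_sin_pi_mul hθ h1 h2
  rw [cotPi, abs_div, abs_of_pos (show 0 < Real.sin (Real.pi * t) by linarith)]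
  exact div_le_div₀ zero_le_one (Real.abs_cos_le_one _) (by positivity) h

/-- The difference of the cotangents has the sign of `sin (π (t - s))`. This makes the total
variation in the Kuzmin–Landau inequality telescope. -/
lemma cotPi_anti {s t : ℝ} (hs : 0 < s) (hst : s ≤ t) (ht : t < 1) : cotPi t ≤ cotPi s := by
  have hpi := Real.pi_pos
  have h1 : 0 < Real.sin (Real.pi * s) :=
    Real.sin_pos_of_pos_of_lt_pi (by positivity) (by nlinarith)
  have h2 : 0 < Real.sin (Real.pi * t) :=
    Real.sin_pos_of_pos_of_lt_pi (by nlinarith) (by nlinarith)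
  rw [cotPi, cotPi, div_le_div_iff₀ h2 h1]
  have := Real.sin_nonneg_of_nonneg_of_le_pi (x := Real.pi * t - Real.pi * s) (by nlinarith)
    (by nlinarith)
  rw [Real.sin_sub] at this
  linarith

/-- `1 / (e(t) - 1)`, in terms of the cotangent. -/
noncomputable def invExpSub (t : ℝ) : ℂ := -1 / 2 - Complex.I / 2 * (cotPi t : ℝ)

lemma mul_invExpSub {t : ℝ} (h : Real.sin (Real.pi * t) ≠ 0) :
    (expTwoPi t - 1) * invExpSub t = 1 := by
  have h' : ((Real.sin (Real.pi * t) : ℝ) : ℂ) ≠ 0 := by exact_mod_cast h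
  have e : expTwoPi t = (((Real.cos (Real.pi * t) : ℝ) : ℂ)
      + ((Real.sin (Real.pi * t) : ℝ) : ℂ) * Complex.I) ^ 2 := by
    rw [expTwoPi, Complex.ofReal_cos, Complex.ofReal_sin, Complex.cos_add_sin_I, sq,
      ← Complex.exp_add]
    congr 1; push_cast; ring
  have hcs : ((Real.cos (Real.pi * t) : ℝ) : ℂ) ^ 2 + ((Real.sin (Real.pi * t) : ℝ) : ℂ) ^ 2 = 1 := by
    exact_mod_cast Real.cos_sq_add_sin_sq _
  rw [e, invExpSub, cotPi]
  rw [Complex.ofReal_div]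
  generalize ((Real.cos (Real.pi * t) : ℝ) : ℂ) = c at *
  generalize ((Real.sin (Real.pi * t) : ℝ) : ℂ) = s at *
  have hI := Complex.I_sq
  field_simp
  linear_combination (s - c * Complex.I) * hcs
    + (-2 * s * c ^ 2 - s ^ 3 - s ^ 2 * c * Complex.I) * hI

lemma norm_invExpSub_le {θ t : ℝ} (hθ : 0 < θ) (h1 : θ ≤ t) (h2 : t ≤ 1 - θ) :
    ‖invExpSub t‖ ≤ 1 / (2 * θ) := by
  have h := abs_cotPi_le hθ h1 h2
  have h3 : 1 ≤ 1 / (2 * θ) := by rw [le_div_iff₀ (by positivity)]; linarith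
  calc ‖invExpSub t‖ ≤ ‖(-1 / 2 : ℂ)‖ + ‖Complex.I / 2 * (cotPi t : ℝ)‖ := norm_sub_le _ _
    _ = 1 / 2 + 1 / 2 * |cotPi t| := by simp
    _ ≤ 1 / (2 * θ) := by linarith

lemma norm_invExpSub_sub {s t : ℝ} (hs : 0 < s) (hst : s ≤ t) (ht : t < 1) :
    ‖invExpSub s - invExpSub t‖ = (cotPi s - cotPi t) / 2 := by
  have e : invExpSub s - invExpSub t = -(Complex.I / 2 * ((cotPi s - cotPi t : ℝ) : ℂ)) := by
    simp only [invExpSub]; push_cast; ring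
  rw [e, norm_neg, norm_mul, Complex.norm_real, Real.norm_eq_abs,
    abs_of_nonneg (sub_nonneg.2 (cotPi_anti hs hst ht))]
  simp; ring

/-- The Kuzmin–Landau inequality. -/
lemma kuzmin_landau {u : ℕ → ℝ} {ν : ℤ} {θ : ℝ} (hθ : 0 < θ) {p q : ℕ}
    (h1 : ∀ n, p ≤ n → n < q → θ ≤ u (n + 1) - u n - ν)
    (h2 : ∀ n, p ≤ n → n < q → u (n + 1) - u n - ν ≤ 1 - θ)
    (hmono : ∀ n, p ≤ n → n + 1 < q → u (n + 1) - u n ≤ u (n + 2) - u (n + 1)) :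
    ‖∑ n ∈ Finset.Ico p q, expTwoPi (u n)‖ ≤ 2 / θ := by
  rcases le_or_gt q p with hqp | hqp
  · rw [Finset.Ico_eq_empty_of_le hqp]; simp; positivity
  set t : ℕ → ℝ := fun n => u (n + 1) - u n - ν with ht
  -- Since `e(u (n+1)) = e(u n) e(t n)`, each term is a difference of consecutive terms divided by
  -- `e(t n) - 1`, ready for summation by parts; the integer `ν` drops out.
  have step : ∀ n, p ≤ n → n < q →
      expTwoPi (u n) = invExpSub (t n) * (expTwoPi (u (n + 1)) - expTwoPi (u n)) := by
    intro n hn hnq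
    have hsin := two_mul_le_sin_pi_mul hθ (h1 n hn hnq) (h2 n hn hnq)
    have e : expTwoPi (u (n + 1)) = expTwoPi (u n) * expTwoPi (t n) := by
      rw [← expTwoPi_add, ← mul_one (expTwoPi (u n + t n)), ← expTwoPi_intCast ν, ← expTwoPi_add]
      congr 1; simp only [ht]; ring
    have := mul_invExpSub (t := t n) (by linarith)
    rw [e]
    linear_combination (-expTwoPi (u n)) * this
  -- Summation by parts with the upper boundary term moved to the left. The coefficients vary only
  -- through the cotangent, monotone along the sum, so the variations telescope.
  have key : ∀ r, p + 1 + r ≤ q →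
      ‖∑ n ∈ Finset.Ico p (p + 1 + r), expTwoPi (u n)
        - invExpSub (t (p + r)) * expTwoPi (u (p + 1 + r))‖
      ≤ ‖invExpSub (t p)‖ + (cotPi (t p) - cotPi (t (p + r))) / 2 := by
    intro r
    induction r with
    | zero =>
      intro hr
      have := step p le_rfl (by omega)
      simp only [add_zero, Nat.Ico_succ_singleton, Finset.sum_singleton, sub_self, zero_div]
      have e : expTwoPi (u p) - invExpSub (t p) * expTwoPi (u (p + 1)) =
          -(invExpSub (t p) * expTwoPi (u p)) := by linear_combination this
      rw [e, norm_neg, norm_mul, norm_expTwoPi, mul_one]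
    | succ r ih =>
      intro hr
      have ih := ih (by omega)
      have hs := step (p + 1 + r) (by omega) (by omega)
      have e0 : p + (r + 1) = p + 1 + r := by ring
      have e1 : p + 1 + (r + 1) = p + 1 + r + 1 := by ring
      rw [e1, e0, Finset.sum_Ico_succ_top (by omega)]
      have e : ∑ n ∈ Finset.Ico p (p + 1 + r), expTwoPi (u n) + expTwoPi (u (p + 1 + r)) -
          invExpSub (t (p + 1 + r)) * expTwoPi (u (p + 1 + r + 1)) =
          (∑ n ∈ Finset.Ico p (p + 1 + r), expTwoPi (u n)
            - invExpSub (t (p + r)) * expTwoPi (u (p + 1 + r))) +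
          (invExpSub (t (p + r)) - invExpSub (t (p + 1 + r))) * expTwoPi (u (p + 1 + r)) := by
        linear_combination hs
      have hm := hmono (p + r) (by omega) (by omega)
      have hb1 := h1 (p + r) (by omega) (by omega)
      have hb2 := h2 (p + 1 + r) (by omega) (by omega)
      have hmt : t (p + r) ≤ t (p + 1 + r) := by
        simp only [ht]
        rw [show p + 1 + r = p + r + 1 by ring]
        linarith
      rw [e]
      refine (norm_add_le _ _).trans ?_
      rw [norm_mul, norm_expTwoPi, mul_one, norm_invExpSub_sub (hθ.trans_le hb1) hmt
        (hb2.trans_lt (by linarith))]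
      linarith
  obtain ⟨r, rfl⟩ : ∃ r, q = p + 1 + r := ⟨q - (p + 1), by omega⟩
  have hk := key r le_rfl
  have b1 := norm_invExpSub_le hθ (h1 p le_rfl (by omega)) (h2 p le_rfl (by omega))
  have b2 := norm_invExpSub_le hθ (h1 (p + r) (by omega) (by omega)) (h2 (p + r) (by omega) (by omega))
  have b3 := abs_le.1 (abs_cotPi_le hθ (h1 p le_rfl (by omega)) (h2 p le_rfl (by omega)))
  have b4 := abs_le.1 (abs_cotPi_le hθ (h1 (p + r) (by omega) (by omega))
    (h2 (p + r) (by omega) (by omega)))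
  have hn := norm_sub_norm_le (∑ n ∈ Finset.Ico p (p + 1 + r), expTwoPi (u n))
    (invExpSub (t (p + r)) * expTwoPi (u (p + 1 + r)))
  rw [norm_mul, norm_expTwoPi, mul_one] at hn
  have e2 : 2 / θ = 4 * (1 / (2 * θ)) := by field_simp; norm_num
  have : 0 < 1 / (2 * θ) := by positivity
  simp only [ht] at *
  linarith [b3.2, b4.1]

lemma exists_eq_Ico_of_ordConnected (s : Finset ℕ)
    (hs : ∀ x ∈ s, ∀ y ∈ s, ∀ z, x ≤ z → z ≤ y → z ∈ s) : ∃ p q, s = Finset.Ico p q := by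
  rcases s.eq_empty_or_nonempty with rfl | hne
  · exact ⟨0, 0, by simp⟩
  · refine ⟨s.min' hne, s.max' hne + 1, ?_⟩
    ext z
    rw [Finset.mem_Ico, Nat.lt_succ_iff]
    exact ⟨fun h => ⟨s.min'_le z h, s.le_max' z h⟩,
      fun h => hs _ (s.min'_mem hne) _ (s.max'_mem hne) z h.1 h.2⟩

lemma mul_le_sub_of_forall_le {a : ℕ → ℝ} {c : ℝ} {M : ℕ} (h : ∀ n < M, c ≤ a (n + 1) - a n)
    {p q : ℕ} (hpq : p ≤ q) (hq : q ≤ M) : (q - p : ℝ) * c ≤ a q - a p := by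
  induction q, hpq using Nat.le_induction with
  | base => simp
  | succ q hpq ih =>
    have := h q (by omega)
    have := ih (by omega)
    push_cast
    linarith

/-- Values of `a` with consecutive gaps at least `c`: only about `θ / c` of them fit in a window of
length `θ`. -/
lemma card_le_of_forall_sub_le {a : ℕ → ℝ} {c θ : ℝ} {M : ℕ} (hc : 0 < c) (hθ : 0 ≤ θ)
    (h : ∀ n < M, c ≤ a (n + 1) - a n) {s : Finset ℕ} (hs : ∀ n ∈ s, n < M)
    (hsθ : ∀ x ∈ s, ∀ y ∈ s, a y - a x ≤ θ) : (s.card : ℝ) ≤ θ / c + 1 := by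
  rcases s.eq_empty_or_nonempty with rfl | hne
  · simp; positivity
  · have hp := s.min'_mem hne
    have hq := s.max'_mem hne
    have hle := s.min'_le _ hq
    have h1 := mul_le_sub_of_forall_le h hle (hs _ hq).le
    have h2 := hsθ _ hp _ hq
    have hcard : s.card ≤ s.max' hne + 1 - s.min' hne := by
      rw [← Nat.card_Ico]
      refine Finset.card_le_card fun z hz => ?_
      rw [Finset.mem_Ico, Nat.lt_succ_iff]
      exact ⟨s.min'_le z hz, s.le_max' z hz⟩
    have hcard' : (s.card : ℝ) + s.min' hne ≤ s.max' hne + 1 := by exact_mod_cast by omega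
    have h3 : (s.max' hne - s.min' hne : ℝ) ≤ θ / c := by
      rw [le_div_iff₀ hc]; linarith
    linarith

/-- The second derivative test for exponential sums, in terms of second differences. -/
lemma norm_sum_expTwoPi_le_of_second_difference {u : ℕ → ℝ} {c C θ : ℝ} {M : ℕ} (hc : 0 < c)
    (hθ : 0 < θ) (h1 : ∀ n < M, c ≤ (u (n + 2) - u (n + 1)) - (u (n + 1) - u n))
    (h2 : ∀ n < M, (u (n + 2) - u (n + 1)) - (u (n + 1) - u n) ≤ C) :
    ‖∑ n ∈ Finset.range M, expTwoPi (u n)‖ ≤ (M * C + 2) * (2 / θ + 2 * (θ / c + 1)) := by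
  set a : ℕ → ℝ := fun n => u (n + 1) - u n with ha
  have ha1 : ∀ n < M, c ≤ a (n + 1) - a n := h1
  have hmono : ∀ {p q : ℕ}, p ≤ q → q ≤ M → a p ≤ a q := by
    intro p q hpq hq
    have := mul_le_sub_of_forall_le ha1 hpq hq
    have h0 : (0 : ℝ) ≤ q - p := sub_nonneg.2 (by exact_mod_cast hpq)
    nlinarith
  have hMC : a M - a 0 ≤ M * C := by
    have := mul_le_sub_of_forall_le (a := fun n => -a n) (c := -C)
      (fun n hn => by have := h2 n hn; simp only [ha]; linarith) (Nat.zero_le M) le_rfl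
    simp only [Nat.cast_zero, sub_zero] at this
    linarith
  have hmaps : ∀ n ∈ Finset.range M, ⌊a n⌋ ∈ Finset.Icc ⌊a 0⌋ ⌊a M⌋ := by
    intro n hn
    rw [Finset.mem_range] at hn
    exact Finset.mem_Icc.2 ⟨Int.floor_mono (hmono (Nat.zero_le n) hn.le),
      Int.floor_mono (hmono hn.le le_rfl)⟩
  have hcard : ((Finset.Icc ⌊a 0⌋ ⌊a M⌋).card : ℝ) ≤ M * C + 2 := by
    have hle : ⌊a 0⌋ ≤ ⌊a M⌋ + 1 :=
      (Int.floor_mono (hmono (Nat.zero_le M) le_rfl)).trans (by omega)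
    have e : (((Finset.Icc ⌊a 0⌋ ⌊a M⌋).card : ℤ) : ℝ) = ((⌊a M⌋ + 1 - ⌊a 0⌋ : ℤ) : ℝ) := by
      rw [Int.card_Icc_of_le _ _ hle]
    rw [Int.cast_natCast] at e
    rw [e]
    push_cast
    linarith [Int.floor_le (a M), Int.lt_floor_add_one (a 0)]
  -- The first differences increase, and their integer parts `ν` take at most `M C + 2` values. For
  -- each `ν`, the indices whose difference is within `θ` of `ν` or `ν + 1` are few and counted
  -- trivially; the others form an interval to which Kuzmin–Landau applies.
  rw [← Finset.sum_fiberwise_of_maps_to hmaps]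
  refine (norm_sum_le_of_le (f := fun ν => ∑ n ∈ Finset.range M with ⌊a n⌋ = ν, expTwoPi (u n))
    (n := fun _ => 2 / θ + 2 * (θ / c + 1)) _ fun ν _ => ?_).trans ?_
  · set s := (Finset.range M).filter fun n => ⌊a n⌋ = ν with hs
    have hmem : ∀ n ∈ s, n < M ∧ (ν : ℝ) ≤ a n ∧ a n < ν + 1 := by
      intro n hn
      rw [hs, Finset.mem_filter, Finset.mem_range, Int.floor_eq_iff] at hn
      exact hn
    have hmem' : ∀ n, n < M → (ν : ℝ) ≤ a n → a n < ν + 1 → n ∈ s := by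
      intro n hn h1 h2
      rw [hs, Finset.mem_filter, Finset.mem_range, Int.floor_eq_iff]
      exact ⟨hn, h1, h2⟩
    rw [← Finset.sum_filter_add_sum_filter_not s (fun n => a n < ν + θ)]
    rw [← Finset.sum_filter_add_sum_filter_not (s.filter fun n => ¬ a n < ν + θ)
      (fun n => a n ≤ ν + 1 - θ)]
    have b1 : ‖∑ n ∈ s with a n < ν + θ, expTwoPi (u n)‖ ≤ θ / c + 1 := by
      refine (norm_sum_expTwoPi_le _ _).trans (card_le_of_forall_sub_le hc hθ.le ha1 ?_ ?_)
      · intro n hn; exact (hmem n (Finset.mem_filter.1 hn).1).1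
      · intro x hx y hy
        have e1 := hmem x (Finset.mem_filter.1 hx).1
        have e2 := (Finset.mem_filter.1 hy).2
        linarith [e1.2.1]
    have b2 : ‖∑ n ∈ (s.filter fun n => ¬ a n < ν + θ) with ¬ a n ≤ ν + 1 - θ, expTwoPi (u n)‖
        ≤ θ / c + 1 := by
      refine (norm_sum_expTwoPi_le _ _).trans (card_le_of_forall_sub_le hc hθ.le ha1 ?_ ?_)
      · intro n hn
        exact (hmem n (Finset.mem_filter.1 (Finset.mem_filter.1 hn).1).1).1
      · intro x hx y hy
        have e1 := hmem y (Finset.mem_filter.1 (Finset.mem_filter.1 hy).1).1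
        have e2 := (Finset.mem_filter.1 hx).2
        linarith [e1.2.2]
    have b3 : ‖∑ n ∈ (s.filter fun n => ¬ a n < ν + θ) with a n ≤ ν + 1 - θ, expTwoPi (u n)‖
        ≤ 2 / θ := by
      have hin : ∀ n, n ∈ (s.filter fun n => ¬ a n < ν + θ).filter (fun n => a n ≤ ν + 1 - θ) ↔
          n < M ∧ ν + θ ≤ a n ∧ a n ≤ ν + 1 - θ := by
        intro n
        rw [Finset.mem_filter, Finset.mem_filter, not_lt]
        constructor
        · rintro ⟨⟨h1, h2⟩, h3⟩
          exact ⟨(hmem n h1).1, h2, h3⟩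
        · rintro ⟨h1, h2, h3⟩
          exact ⟨⟨hmem' n h1 (by linarith) (by linarith), h2⟩, h3⟩
      obtain ⟨p, q, hpq⟩ := exists_eq_Ico_of_ordConnected
        ((s.filter fun n => ¬ a n < ν + θ).filter (fun n => a n ≤ ν + 1 - θ)) (by
          intro x hx y hy z hxz hzy
          rw [hin] at hx hy ⊢
          exact ⟨hzy.trans_lt hy.1, hx.2.1.trans (hmono hxz (hzy.trans hy.1.le)),
            (hmono hzy hy.1.le).trans hy.2.2⟩)
      have hin' : ∀ n, p ≤ n → n < q → n < M ∧ ν + θ ≤ a n ∧ a n ≤ ν + 1 - θ := by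
        intro n h1 h2
        rw [← hin, hpq]
        exact Finset.mem_Ico.2 ⟨h1, h2⟩
      rw [hpq]
      refine kuzmin_landau (ν := ν) hθ ?_ ?_ ?_
      · intro n hn hnq; have := hin' n hn hnq; simp only [ha] at this; linarith [this.2.1]
      · intro n hn hnq; have := hin' n hn hnq; simp only [ha] at this; linarith [this.2.2]
      · intro n hn hnq
        exact hmono (Nat.le_succ n) (hin' n hn (by omega)).1
    refine (norm_add_le _ _).trans ?_
    have := norm_add_le
      (∑ n ∈ (s.filter fun n => ¬ a n < ν + θ) with a n ≤ ν + 1 - θ, expTwoPi (u n))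
      (∑ n ∈ (s.filter fun n => ¬ a n < ν + θ) with ¬ a n ≤ ν + 1 - θ, expTwoPi (u n))
    linarith
  · rw [Finset.sum_const, nsmul_eq_mul]
    gcongr

/-! ### Van der Corput's inequality -/

/-- The shifted window `[j, M + H + j)` contains the support `[H, M + H)` whenever `j ≤ H`. -/
lemma sum_range_add_eq_of_support {F : ℕ → ℂ} {M H j : ℕ} (hj : j ≤ H)
    (hF : ∀ n, ¬ (H ≤ n ∧ n < M + H) → F n = 0) :
    ∑ m ∈ Finset.range (M + H), F (m + j) = ∑ n ∈ Finset.range M, F (n + H) := by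
  rw [Finset.range_eq_Ico, Finset.range_eq_Ico, Finset.sum_Ico_add' F, Finset.sum_Ico_add' F]
  symm
  refine Finset.sum_subset ?_ ?_
  · intro x hx
    rw [Finset.mem_Ico] at hx ⊢
    omega
  · intro x _ hx
    exact hF x fun h => hx (Finset.mem_Ico.2 (by omega))

/-- Padded by zeros, each `z n` lies in exactly `H` windows of length `H`, so the sum is the average
of the window sums. Cauchy–Schwarz and expansion of the squares leave correlations that depend only
on the difference of the two shifts: `H` diagonal ones of size at most `M`, the rest at most `B`. -/
lemma van_der_corput {z : ℕ → ℂ} {M H : ℕ} {B : ℝ} (hH : 1 ≤ H) (hz : ∀ n, ‖z n‖ ≤ 1)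
    (hB : ∀ h, 1 ≤ h → h < H →
      ‖∑ n ∈ Finset.range (M - h), z (n + h) * (starRingEnd ℂ) (z n)‖ ≤ B) (hB0 : 0 ≤ B) :
    ‖∑ n ∈ Finset.range M, z n‖ ^ 2 ≤ (M + H) * (M / H + B) := by
  set y : ℕ → ℂ := fun n => if H ≤ n ∧ n < M + H then z (n - H) else 0 with hy
  have hysupp : ∀ n, ¬ (H ≤ n ∧ n < M + H) → y n = 0 := fun n hn => if_neg hn
  set w : ℕ → ℂ := fun m => ∑ j ∈ Finset.range H, y (m + j) with hw
  have hsum : ∑ m ∈ Finset.range (M + H), w m = H * ∑ n ∈ Finset.range M, z n := by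
    rw [hw, Finset.sum_comm]
    rw [Finset.sum_congr rfl fun j hj =>
      sum_range_add_eq_of_support (Finset.mem_range.1 hj).le hysupp]
    rw [Finset.sum_const, Finset.card_range, nsmul_eq_mul]
    congr 1
    refine Finset.sum_congr rfl fun n hn => ?_
    rw [Finset.mem_range] at hn
    simp only [hy]
    rw [if_pos (by omega), Nat.add_sub_cancel]
  have hcorr : ∀ j' < H, ∀ h, j' + h < H →
      ∑ m ∈ Finset.range (M + H), y (m + (j' + h)) * (starRingEnd ℂ) (y (m + j')) =
      ∑ n ∈ Finset.range (M - h), z (n + h) * (starRingEnd ℂ) (z n) := by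
    intro j' hj' h hh
    have := sum_range_add_eq_of_support (F := fun n => y (n + h) * (starRingEnd ℂ) (y n))
      (M := M) hj'.le (fun n hn => by simp [hysupp n hn])
    simp only [add_assoc] at this
    rw [this]
    symm
    rw [← Finset.sum_subset (Finset.range_subset_range.2 (Nat.sub_le M h))]
    · refine Finset.sum_congr rfl fun n hn => ?_
      rw [Finset.mem_range] at hn
      simp only [hy]
      rw [if_pos (by omega), if_pos (by omega), Nat.add_sub_cancel]
      congr 2
      omega
    · intro n hn hn'
      rw [Finset.mem_range] at hn hn'
      rw [hysupp (n + (H + h)) (by omega), zero_mul]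
  have hdiag : ‖∑ n ∈ Finset.range (M - 0), z (n + 0) * (starRingEnd ℂ) (z n)‖ ≤ M := by
    refine (norm_sum_le_of_le _ (n := fun _ => (1 : ℝ)) fun n _ => ?_).trans (by simp)
    rw [norm_mul, RCLike.norm_conj]
    exact mul_le_one₀ (hz _) (norm_nonneg _) (hz _)
  have hcorr' : ∀ i < H, ∀ j < H,
      ‖∑ m ∈ Finset.range (M + H), y (m + i) * (starRingEnd ℂ) (y (m + j))‖
        ≤ (if i = j then (M : ℝ) else 0) + B := by
    have aux : ∀ j < H, ∀ h, j + h < H →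
        ‖∑ m ∈ Finset.range (M + H), y (m + (j + h)) * (starRingEnd ℂ) (y (m + j))‖
        ≤ (if j + h = j then (M : ℝ) else 0) + B := by
      intro j hj h hh
      rw [hcorr j hj h hh]
      rcases Nat.eq_zero_or_pos h with rfl | h0
      · rw [if_pos (by simp)]; linarith
      · rw [if_neg (by omega), zero_add]
        exact hB h h0 (by omega)
    intro i hi j hj
    rcases le_total j i with hle | hle
    · obtain ⟨h, rfl⟩ := Nat.exists_eq_add_of_le hle
      exact aux j hj h hi
    · obtain ⟨h, rfl⟩ := Nat.exists_eq_add_of_le hle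
      have := aux i hi h hj
      rw [← RCLike.norm_conj, map_sum] at this
      simp only [map_mul, RingHomCompTriple.comp_apply, RingHom.id_apply, eq_comm (a := i + h)] at this
      simpa only [mul_comm] using this
  have hsq : ∑ m ∈ Finset.range (M + H), ‖w m‖ ^ 2 ≤ H * M + H ^ 2 * B := by
    have e : ((∑ m ∈ Finset.range (M + H), ‖w m‖ ^ 2 : ℝ) : ℂ) =
        ∑ i ∈ Finset.range H, ∑ j ∈ Finset.range H,
          ∑ m ∈ Finset.range (M + H), y (m + i) * (starRingEnd ℂ) (y (m + j)) := by
      push_cast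
      rw [Finset.sum_congr rfl fun m _ => (Complex.mul_conj' (w m)).symm]
      simp only [hw, map_sum, Finset.sum_mul_sum]
      rw [Finset.sum_comm]
      exact Finset.sum_congr rfl fun i _ => Finset.sum_comm
    have h0 : 0 ≤ ∑ m ∈ Finset.range (M + H), ‖w m‖ ^ 2 := by positivity
    rw [← abs_of_nonneg h0, ← Real.norm_eq_abs, ← Complex.norm_real, e]
    refine (norm_sum_le_of_le _ (n := fun _ => M + H * B) fun i hi => ?_).trans_eq ?_
    · refine (norm_sum_le_of_le _ fun j hj =>
        hcorr' i (Finset.mem_range.1 hi) j (Finset.mem_range.1 hj)).trans_eq ?_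
      rw [Finset.sum_add_distrib, Finset.sum_ite_eq, if_pos hi]
      simp
    · rw [Finset.sum_const, Finset.card_range, nsmul_eq_mul]; ring
  have hcs : ‖∑ m ∈ Finset.range (M + H), w m‖ ^ 2 ≤
      (M + H) * ∑ m ∈ Finset.range (M + H), ‖w m‖ ^ 2 := by
    have h1 := norm_sum_le (Finset.range (M + H)) w
    have h2 := sq_sum_le_card_mul_sum_sq (s := Finset.range (M + H)) (f := fun m => ‖w m‖)
    rw [Finset.card_range] at h2
    push_cast at h2
    exact (pow_le_pow_left₀ (norm_nonneg _) h1 2).trans h2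
  rw [hsum, norm_mul, Complex.norm_natCast, mul_pow] at hcs
  have hHpos : (0 : ℝ) < H := by exact_mod_cast hH
  have hfin : (H : ℝ) ^ 2 * ‖∑ n ∈ Finset.range M, z n‖ ^ 2 ≤
      H ^ 2 * ((M + H) * (M / H + B)) := by
    refine hcs.trans ((mul_le_mul_of_nonneg_left hsq (by positivity)).trans_eq ?_)
    field_simp
  exact le_of_mul_le_mul_left hfin (by positivity)

/-! ### Power savings for exponential sums -/

lemma fwdDiff_iter_shift_sub (u : ℕ → ℝ) (h k n : ℕ) :
    (fwdDiff 1)^[k] (fun n => u (n + h) - u n) n =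
      (fwdDiff 1)^[k] u (n + h) - (fwdDiff 1)^[k] u n := by
  induction k generalizing n with
  | zero => rfl
  | succ k ih =>
    simp only [Function.iterate_succ_apply', fwdDiff]
    rw [ih, ih, show n + 1 + h = n + h + 1 by ring]
    ring

/-- By telescoping, two-sided bounds for differences of order `k + 1` pass to differences of order
`k` of the shifted sequence, at the cost of a factor `h`. This drives the induction on the order. -/
lemma fwdDiff_iter_shift_sub_eq_sum (u : ℕ → ℝ) (h k n : ℕ) :
    (fwdDiff 1)^[k] (fun n => u (n + h) - u n) n =
      ∑ i ∈ Finset.range h, (fwdDiff 1)^[k + 1] u (n + i) := by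
  rw [fwdDiff_iter_shift_sub]
  have := Finset.sum_range_sub (fun i => (fwdDiff 1)^[k] u (n + i)) h
  rw [add_zero] at this
  rw [← this]
  refine Finset.sum_congr rfl fun i _ => ?_
  rw [Function.iterate_succ_apply', fwdDiff, add_assoc]

lemma eventually_natCast_mul_rpow_le (K : ℝ) {a b : ℝ} (hab : a < b) :
    ∀ᶠ N : ℕ in atTop, K * (N : ℝ) ^ a ≤ (N : ℝ) ^ b :=
  tendsto_natCast_atTop_atTop.eventually (eventually_mul_rpow_le K hab)

lemma norm_sum_le_of_second_difference_bounds {γ : ℝ} (h0 : 0 < γ) (h2 : γ < 2) :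
    ∃ η : ℝ, 0 < η ∧ ∀ᶠ N : ℕ in atTop, ∀ (M : ℕ) (u : ℕ → ℝ), M ≤ N →
      (∀ n < M, (N : ℝ) ^ (-γ - η) ≤ (fwdDiff 1)^[2] u n ∧
        (fwdDiff 1)^[2] u n ≤ (N : ℝ) ^ (-γ + η)) →
      ‖∑ n ∈ Finset.range M, expTwoPi (u n)‖ ≤ (N : ℝ) ^ (1 - η) := by
  -- Small enough that `1 - γ/2 + 3η/2` and `γ/2 + η/2`, the exponents coming out of the second
  -- derivative test, stay below `1 - η`.
  set η := min γ (2 - γ) / 6 with hη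
  have e1 : η ≤ γ / 6 := by rw [hη]; gcongr; exact min_le_left _ _
  have e2 : η ≤ (2 - γ) / 6 := by rw [hη]; gcongr; exact min_le_right _ _
  have e0 : 0 < η := by have : 0 < min γ (2 - γ) := lt_min h0 (by linarith)
                        positivity
  refine ⟨η, e0, ?_⟩
  filter_upwards [eventually_natCast_mul_rpow_le 12 (a := 1 - γ / 2 + 3 * η / 2) (b := 1 - η)
    (by linarith), eventually_natCast_mul_rpow_le 24 (a := γ / 2 + η / 2) (b := 1 - η)
    (by linarith), eventually_ge_atTop 1] with N hN1 hN2 hN M u hM hu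
  have hNpos : (0 : ℝ) < N := by exact_mod_cast hN
  have hN1' : (1 : ℝ) ≤ N := by exact_mod_cast hN
  set c := (N : ℝ) ^ (-γ - η) with hc
  -- The square root of `c`, which balances `2 / θ` against `2 θ / c`.
  set θ := (N : ℝ) ^ ((-γ - η) / 2) with hθ
  have hc0 : 0 < c := by positivity
  have hθ0 : 0 < θ := by positivity
  have hd : ∀ n, (fwdDiff 1)^[2] u n = (u (n + 2) - u (n + 1)) - (u (n + 1) - u n) := fun n => rfl
  have key := norm_sum_expTwoPi_le_of_second_difference (M := M) hc0 hθ0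
    (fun n hn => by rw [← hd]; exact (hu n hn).1) (fun n hn => by rw [← hd]; exact (hu n hn).2)
  have hinv : 2 / θ = 2 * (N : ℝ) ^ (γ / 2 + η / 2) := by
    rw [hθ, div_eq_mul_inv, ← Real.rpow_neg hNpos.le]; ring_nf
  have hdiv : θ / c = (N : ℝ) ^ (γ / 2 + η / 2) := by
    rw [hθ, hc, ← Real.rpow_sub hNpos]; ring_nf
  rw [hinv, hdiv] at key
  have hone : 1 ≤ (N : ℝ) ^ (γ / 2 + η / 2) := Real.one_le_rpow hN1' (by linarith)
  have hMN : (M : ℝ) ≤ N := by exact_mod_cast hM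
  have hprod : (N : ℝ) * (N : ℝ) ^ (-γ + η) * (N : ℝ) ^ (γ / 2 + η / 2) =
      (N : ℝ) ^ (1 - γ / 2 + 3 * η / 2) := by
    rw [show (N : ℝ) * (N : ℝ) ^ (-γ + η) = (N : ℝ) ^ (1 + (-γ + η)) by
      rw [Real.rpow_add hNpos 1, Real.rpow_one], ← Real.rpow_add hNpos]
    ring_nf
  calc ‖∑ n ∈ Finset.range M, expTwoPi (u n)‖
      ≤ _ := key
    _ ≤ (N * (N : ℝ) ^ (-γ + η) + 2) * (6 * (N : ℝ) ^ (γ / 2 + η / 2)) := by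
        gcongr; linarith
    _ = (12 * (N : ℝ) ^ (1 - γ / 2 + 3 * η / 2) + 24 * (N : ℝ) ^ (γ / 2 + η / 2)) / 2 := by
        rw [← hprod]; ring
    _ ≤ (N : ℝ) ^ (1 - η) := by linarith

/-- A sequence whose differences of order at least two are of size about `N ^ (-γ)` has
exponential sums with a power saving. -/
theorem norm_sum_le_of_difference_bounds {γ : ℝ} (h0 : 0 < γ) (h2 : γ < 2) (k : ℕ) :
    ∃ η : ℝ, 0 < η ∧ ∀ᶠ N : ℕ in atTop, ∀ (M : ℕ) (u : ℕ → ℝ), M ≤ N →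
      (∀ n < M, (N : ℝ) ^ (-γ - η) ≤ (fwdDiff 1)^[k + 2] u n ∧
        (fwdDiff 1)^[k + 2] u n ≤ (N : ℝ) ^ (-γ + η)) →
      ‖∑ n ∈ Finset.range M, expTwoPi (u n)‖ ≤ (N : ℝ) ^ (1 - η) := by
  induction k with
  | zero => exact norm_sum_le_of_second_difference_bounds h0 h2
  | succ k ih =>
    obtain ⟨η₀, hη₀, ih⟩ := ih
    obtain ⟨η, hη, hη1, hηle⟩ : ∃ η, 0 < η ∧ η < 1 ∧ η ≤ η₀ :=
      ⟨min η₀ (1 / 2), by positivity, (min_le_right _ _).trans_lt (by norm_num), min_le_left _ _⟩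
    refine ⟨η / 8, by positivity, ?_⟩
    filter_upwards [ih, eventually_natCast_mul_rpow_le 6 (a := 2 - η / 2) (b := 2 - η / 4)
      (by linarith), eventually_ge_atTop 1] with N ihN hN6 hN M u hM hu
    have hNpos : (0 : ℝ) < N := by exact_mod_cast hN
    have hN1' : (1 : ℝ) ≤ N := by exact_mod_cast hN
    have hMN : (M : ℝ) ≤ N := by exact_mod_cast hM
    -- A small power of `N`, so that the factor `h < H` fits into the tolerance `η₀` of the
    -- induction hypothesis. Squared, the sum is at most `6 N^(2 - η/2)`; the loss from `η/2` to
    -- `η/4` absorbs the 6 and the square root leaves `η/8`.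
    set H := ⌈(N : ℝ) ^ (η / 2)⌉₊ with hH
    have hNη : 1 ≤ (N : ℝ) ^ (η / 2) := Real.one_le_rpow hN1' (by linarith)
    have hH1 : (N : ℝ) ^ (η / 2) ≤ H := Nat.le_ceil _
    have hH2 : (H : ℝ) ≤ 2 * N := by
      have h1 : (H : ℝ) < (N : ℝ) ^ (η / 2) + 1 := Nat.ceil_lt_add_one (by positivity)
      have h2 : (N : ℝ) ^ (η / 2) ≤ (N : ℝ) ^ (1 : ℝ) :=
        Real.rpow_le_rpow_of_exponent_le hN1' (by linarith)
      rw [Real.rpow_one] at h2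
      linarith
    have hHpos : 1 ≤ H := by exact_mod_cast hNη.trans hH1
    have hcorr : ∀ h, 1 ≤ h → h < H →
        ‖∑ n ∈ Finset.range (M - h), expTwoPi (u (n + h)) * (starRingEnd ℂ) (expTwoPi (u n))‖
          ≤ (N : ℝ) ^ (1 - η₀) := by
      intro h hh1 hhH
      simp_rw [conj_expTwoPi, ← expTwoPi_add, ← sub_eq_add_neg]
      refine ihN (M - h) (fun n => u (n + h) - u n) ((Nat.sub_le _ _).trans hM) fun n hn => ?_
      rw [fwdDiff_iter_shift_sub_eq_sum]
      have hh1' : (1 : ℝ) ≤ h := by exact_mod_cast hh1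
      have hhle : (h : ℝ) ≤ (N : ℝ) ^ (η / 2) := (Nat.lt_ceil.1 hhH).le
      have hb : ∀ i ∈ Finset.range h, _ := fun i hi => hu (n + i) (by
        rw [Finset.mem_range] at hi; omega)
      constructor
      · calc (N : ℝ) ^ (-γ - η₀) ≤ (N : ℝ) ^ (-γ - η / 8) :=
            Real.rpow_le_rpow_of_exponent_le hN1' (by linarith)
          _ ≤ h * (N : ℝ) ^ (-γ - η / 8) := le_mul_of_one_le_left (by positivity) hh1'
          _ = h • (N : ℝ) ^ (-γ - η / 8) := (nsmul_eq_mul _ _).symm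
          _ = (Finset.range h).card • (N : ℝ) ^ (-γ - η / 8) := by rw [Finset.card_range]
          _ ≤ _ := Finset.card_nsmul_le_sum _ _ _ fun i hi => (hb i hi).1
      · calc _ ≤ (Finset.range h).card • (N : ℝ) ^ (-γ + η / 8) :=
            Finset.sum_le_card_nsmul _ _ _ fun i hi => (hb i hi).2
          _ = h * (N : ℝ) ^ (-γ + η / 8) := by rw [Finset.card_range, nsmul_eq_mul]
          _ ≤ (N : ℝ) ^ (η / 2) * (N : ℝ) ^ (-γ + η / 8) := by gcongr
          _ = (N : ℝ) ^ (η / 2 + (-γ + η / 8)) := by rw [← Real.rpow_add hNpos]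
          _ ≤ (N : ℝ) ^ (-γ + η₀) := Real.rpow_le_rpow_of_exponent_le hN1' (by linarith)
    have key := van_der_corput hHpos (fun n => (norm_expTwoPi (u n)).le) hcorr (by positivity)
      (M := M)
    have hMH : (M : ℝ) / H ≤ (N : ℝ) ^ (1 - η / 2) := by
      rw [Real.rpow_sub hNpos, Real.rpow_one]; gcongr
    have hη₀' : (N : ℝ) ^ (1 - η₀) ≤ (N : ℝ) ^ (1 - η / 2) :=
      Real.rpow_le_rpow_of_exponent_le hN1' (by linarith)
    rw [← abs_of_nonneg (Real.rpow_nonneg hNpos.le (1 - η / 8)), ← abs_norm, ← sq_le_sq]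
    calc _ ≤ _ := key
      _ ≤ (N + 2 * N) * ((N : ℝ) ^ (1 - η / 2) + (N : ℝ) ^ (1 - η / 2)) := by gcongr
      _ = 6 * (N ^ (1 : ℝ) * (N : ℝ) ^ (1 - η / 2)) := by rw [Real.rpow_one]; ring
      _ = 6 * (N : ℝ) ^ (2 - η / 2) := by rw [← Real.rpow_add hNpos]; ring_nf
      _ ≤ (N : ℝ) ^ (2 - η / 4) := hN6
      _ = ((N : ℝ) ^ (1 - η / 8)) ^ 2 := by
        rw [← Real.rpow_natCast, ← Real.rpow_mul hNpos.le]; push_cast; ring_nf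

/-! ### Fourier approximation -/

/-- The periodic second Bernoulli function. -/
noncomputable def bernoulliTwo (x : ℝ) : ℝ := Int.fract x ^ 2 - Int.fract x + 1 / 6

lemma hasSum_cos_bernoulliTwo (x : ℝ) :
    HasSum (fun n : ℕ => 1 / (n : ℝ) ^ 2 * Real.cos (2 * Real.pi * n * x))
      (Real.pi ^ 2 * bernoulliTwo x) := by
  have h := hasSum_one_div_nat_pow_mul_cos one_ne_zero (x := Int.fract x)
    ⟨Int.fract_nonneg x, (Int.fract_lt_one x).le⟩
  convert h using 1
  · funext n
    congr 1
    have e : 2 * Real.pi * n * Int.fract x = 2 * Real.pi * n * x - ((n * ⌊x⌋ : ℤ) : ℝ) * (2 * Real.pi) := by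
      rw [Int.fract]; push_cast; ring
    rw [e, Real.cos_sub_int_mul_two_pi]
  · have e : ((Polynomial.bernoulli 2).map (algebraMap ℚ ℝ)).eval (Int.fract x) =
        bernoulliTwo x := by
      simp [Polynomial.bernoulli, Finset.sum_range_succ, _root_.bernoulli_two, bernoulliTwo]
      ring
    rw [mul_one, e, Nat.factorial_two]
    push_cast
    ring

/-- The Fourier coefficients `1/n²` split as `n^(-3/2) n^(-1/2)`: the first factor is summable, and
the second yields `1/√H` for the frequencies beyond `H`, bounded trivially. The translation `t` only
turns each exponential sum by a unimodular factor. -/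
lemma abs_sum_bernoulliTwo_le : ∃ C : ℝ, 0 < C ∧ ∀ (s : Finset ℕ) (y : ℕ → ℝ) (H : ℕ) (B : ℝ),
    1 ≤ H → (∀ h : ℕ, 1 ≤ h → h ≤ H → ‖∑ m ∈ s, expTwoPi (h * y m)‖ ≤ B) →
    ∀ t : ℝ, |∑ m ∈ s, bernoulliTwo (y m + t)| ≤ C * (B + s.card / Real.sqrt H) := by
  set a : ℕ → ℝ := fun n => 1 / (n : ℝ) ^ (3 / 2 : ℝ) with ha
  have hasum : Summable a := Real.summable_one_div_nat_rpow.2 (by norm_num)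
  refine ⟨1 + ∑' n, a n, by have : 0 ≤ ∑' n, a n := tsum_nonneg fun n => by positivity
                            linarith, ?_⟩
  intro s y H B hH hB t
  have hB0 : 0 ≤ B := (norm_nonneg _).trans (hB 1 le_rfl hH)
  have hHpos : (0 : ℝ) < H := by exact_mod_cast hH
  have hs := hasSum_sum (s := s) fun m _ => hasSum_cos_bernoulliTwo (y m + t)
  rw [← Finset.mul_sum] at hs
  have hterm : ∀ n : ℕ, ‖∑ m ∈ s, 1 / (n : ℝ) ^ 2 * Real.cos (2 * Real.pi * n * (y m + t))‖ ≤
      a n * (B + s.card / Real.sqrt H) := by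
    intro n
    rcases Nat.eq_zero_or_pos n with rfl | hn
    -- At frequency zero both sides vanish, since `1 / 0 = 0`.
    · simp [ha]
    have hn' : (1 : ℝ) ≤ n := by exact_mod_cast hn
    have hn0 : (0 : ℝ) < n := by linarith
    have hcos : |∑ m ∈ s, Real.cos (2 * Real.pi * n * (y m + t))| ≤
        ‖∑ m ∈ s, expTwoPi (n * y m)‖ := by
      have e : ∑ m ∈ s, Real.cos (2 * Real.pi * n * (y m + t)) =
          (∑ m ∈ s, expTwoPi (n * y m) * expTwoPi (n * t)).re := by
        rw [Complex.re_sum]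
        refine Finset.sum_congr rfl fun m _ => ?_
        rw [← expTwoPi_add, re_expTwoPi]
        congr 1; ring
      rw [e, ← Finset.sum_mul]
      refine (Complex.abs_re_le_norm _).trans ?_
      rw [norm_mul, norm_expTwoPi, mul_one]
    rw [← Finset.mul_sum, norm_mul, Real.norm_eq_abs, Real.norm_eq_abs,
      abs_of_nonneg (by positivity)]
    have ha2 : 1 / (n : ℝ) ^ 2 = a n * (1 / Real.sqrt n) := by
      rw [ha, Real.sqrt_eq_rpow, ← Real.rpow_natCast, div_mul_div_comm, one_mul,
        ← Real.rpow_add hn0]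
      norm_num
    have ha0 : 0 < a n := by positivity
    have hsq : 1 ≤ Real.sqrt n := Real.one_le_sqrt.2 hn'
    rw [ha2, mul_assoc]
    gcongr
    rcases le_or_gt n H with h | h
    · calc 1 / Real.sqrt n * |∑ m ∈ s, Real.cos (2 * Real.pi * n * (y m + t))|
          ≤ 1 * B := by
            gcongr
            · exact (div_le_one (by linarith)).2 hsq
            · exact hcos.trans (hB n hn h)
        _ ≤ _ := by rw [one_mul]; exact le_add_of_nonneg_right (by positivity)
    · calc 1 / Real.sqrt n * |∑ m ∈ s, Real.cos (2 * Real.pi * n * (y m + t))|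
          ≤ 1 / Real.sqrt H * s.card := by
            gcongr
            exact hcos.trans (norm_sum_expTwoPi_le _ _)
        _ = s.card / Real.sqrt H := by ring
        _ ≤ _ := le_add_of_nonneg_left hB0
  have hbound := tsum_of_norm_bounded (hasum.hasSum.mul_right (B + s.card / Real.sqrt H)) hterm
  rw [hs.tsum_eq, norm_mul, Real.norm_eq_abs, Real.norm_eq_abs, abs_of_nonneg (by positivity)]
    at hbound
  have hpi : 1 ≤ Real.pi ^ 2 := by nlinarith [Real.pi_gt_three]
  have hnn : 0 ≤ B + s.card / Real.sqrt H := by positivity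
  calc |∑ m ∈ s, bernoulliTwo (y m + t)|
      ≤ Real.pi ^ 2 * |∑ m ∈ s, bernoulliTwo (y m + t)| := le_mul_of_one_le_left (abs_nonneg _) hpi
    _ ≤ _ := hbound
    _ ≤ _ := by gcongr; linarith

/-- The function B₂ is the minimum of the integer translates of one parabola; the right side is the
translate that is active at `x`, evaluated at `x + δ`. -/
lemma bernoulliTwo_add_le (x δ : ℝ) :
    bernoulliTwo (x + δ) ≤ bernoulliTwo x + 2 * δ * (Int.fract x - 1 / 2) + δ ^ 2 := by
  have h1 := Int.fract_nonneg (x + δ)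
  have h2 := Int.fract_lt_one (x + δ)
  have e : Int.fract x + δ = Int.fract (x + δ) + ((⌊x + δ⌋ - ⌊x⌋ : ℤ) : ℝ) := by
    simp only [Int.fract]; push_cast; ring
  set r := Int.fract (x + δ)
  set n : ℤ := ⌊x + δ⌋ - ⌊x⌋
  have hn : 0 ≤ (n : ℝ) * (n - 1 + 2 * r) := by
    rcases lt_trichotomy n 0 with h | h | h
    · have : (n : ℝ) ≤ -1 := by exact_mod_cast Int.le_sub_one_of_lt h
      exact mul_nonneg_of_nonpos_of_nonpos (by linarith) (by linarith)
    · simp [h]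
    · have : (1 : ℝ) ≤ n := by exact_mod_cast h
      exact mul_nonneg (by linarith) (by linarith)
  have hδ : δ = r + n - Int.fract x := by linarith
  simp only [bernoulliTwo]
  change r ^ 2 - r + 1 / 6 ≤ _
  rw [hδ]
  nlinarith

/-- The one-sided parabola bound, used with `δ` and with `-δ`, bounds the sawtooth sum from both
sides by difference quotients of B₂ sums. -/
lemma abs_sum_fract_le {R δ : ℝ} (hδ : 0 < δ) {s : Finset ℕ} {y : ℕ → ℝ}
    (h : ∀ t : ℝ, |∑ m ∈ s, bernoulliTwo (y m + t)| ≤ R) (t : ℝ) :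
    |∑ m ∈ s, (Int.fract (y m + t) - 1 / 2)| ≤ R / δ + s.card * δ := by
  have key : ∀ d : ℝ, ∑ m ∈ s, bernoulliTwo (y m + (t + d)) ≤ ∑ m ∈ s, bernoulliTwo (y m + t)
      + 2 * d * ∑ m ∈ s, (Int.fract (y m + t) - 1 / 2) + s.card * d ^ 2 := by
    intro d
    rw [Finset.mul_sum, ← nsmul_eq_mul, ← Finset.sum_const, ← Finset.sum_add_distrib,
      ← Finset.sum_add_distrib]
    refine Finset.sum_le_sum fun m _ => ?_
    rw [← add_assoc]
    exact bernoulliTwo_add_le _ _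
  have k1 := key δ
  have k2 := key (-δ)
  have a0 := abs_le.1 (h t)
  have a1 := abs_le.1 (h (t + δ))
  have a2 := abs_le.1 (h (t + -δ))
  have e : R / δ + s.card * δ = (R + s.card * δ ^ 2) / δ := by field_simp
  have hc : (0 : ℝ) ≤ s.card * δ ^ 2 := by positivity
  rw [e, le_div_iff₀ hδ, ← abs_of_pos hδ, ← abs_mul, abs_of_pos hδ, abs_le]
  constructor <;> nlinarith

lemma chi_eq_fract (x : ℝ) :
    (chi x : ℝ) = 2 * (Int.fract (x + 1 / 2) - 1 / 2) - 2 * (Int.fract (x + 0) - 1 / 2) := by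
  have h0 := Int.fract_nonneg x
  have h1 := Int.fract_lt_one x
  rw [add_zero, chi]
  split_ifs with h
  · have : Int.fract (x + 1 / 2) = Int.fract x + 1 / 2 := by
      rw [Int.fract_eq_iff]
      exact ⟨by linarith, by linarith, ⌊x⌋, by rw [Int.fract]; ring⟩
    rw [this]; push_cast; ring
  · have : Int.fract (x + 1 / 2) = Int.fract x - 1 / 2 := by
      rw [Int.fract_eq_iff]
      exact ⟨by linarith, by linarith, ⌊x⌋ + 1, by rw [Int.fract]; push_cast; ring⟩
    rw [this]; push_cast; ring

/-- An Erdős–Turán type inequality for the sign function `χ`. -/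
theorem abs_sum_chi_le : ∃ C : ℝ, 0 < C ∧ ∀ (s : Finset ℕ) (y : ℕ → ℝ) (H : ℕ) (B δ : ℝ),
    1 ≤ H → 0 < δ → (∀ h : ℕ, 1 ≤ h → h ≤ H → ‖∑ m ∈ s, expTwoPi (h * y m)‖ ≤ B) →
    |∑ m ∈ s, (chi (y m) : ℝ)| ≤ C * ((B + s.card / Real.sqrt H) / δ + s.card * δ) := by
  obtain ⟨C, hC, h⟩ := abs_sum_bernoulliTwo_le
  refine ⟨4 * (C + 1), by positivity, fun s y H B δ hH hδ hB => ?_⟩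
  have hB0 : 0 ≤ B := (norm_nonneg _).trans (hB 1 le_rfl hH)
  have h1 := abs_sum_fract_le hδ (h s y H B hH hB)
  simp_rw [chi_eq_fract]
  rw [Finset.sum_sub_distrib, ← Finset.mul_sum, ← Finset.mul_sum]
  have b1 := abs_le.1 (h1 (1 / 2))
  have b2 := abs_le.1 (h1 0)
  have e : C * (B + s.card / Real.sqrt H) / δ = C * ((B + s.card / Real.sqrt H) / δ) := by ring
  rw [e] at b1 b2
  have p1 : 0 ≤ (B + s.card / Real.sqrt H) / δ := by positivity
  have p2 : 0 ≤ s.card * δ := by positivity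
  have p3 : 0 ≤ C * (s.card * δ) := by positivity
  rw [abs_le]
  constructor <;> nlinarith

/-! ### Differences of smooth functions along arithmetic progressions -/

lemma hasDerivAt_fwdDiff_iter {g g' : ℝ → ℝ} {a x₀ : ℝ} (ha : 0 ≤ a)
    (hg : ∀ x, x₀ ≤ x → HasDerivAt g (g' x) x) (j : ℕ) :
    ∀ x, x₀ ≤ x → HasDerivAt ((fwdDiff a)^[j] g) ((fwdDiff a)^[j] g' x) x := by
  induction j with
  | zero => exact hg
  | succ j ih =>
    intro x hx
    rw [Function.iterate_succ_apply', Function.iterate_succ_apply']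
    exact ((ih (x + a) (by linarith)).comp_add_const x a).sub (ih x hx)

/-- The mean value theorem for iterated differences. -/
lemma fwdDiff_iter_mem_Icc {F : ℕ → ℝ → ℝ} {a c C x₀ x₁ : ℝ} {k : ℕ} (ha : 0 < a)
    (hF : ∀ i < k, ∀ x, x₀ ≤ x → HasDerivAt (F i) (F (i + 1) x) x)
    (hb : ∀ x, x₀ ≤ x → x ≤ x₁ → c ≤ F k x ∧ F k x ≤ C) (j : ℕ) :
    ∀ i, i + j = k → ∀ x, x₀ ≤ x → x + j * a ≤ x₁ →
      a ^ j * c ≤ (fwdDiff a)^[j] (F i) x ∧ (fwdDiff a)^[j] (F i) x ≤ a ^ j * C := by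
  induction j with
  | zero =>
    rintro i rfl x hx hx1
    simpa using hb x hx (by simpa using hx1)
  | succ j ih =>
    intro i hi x hx hx1
    push_cast at hx1
    have hd := hasDerivAt_fwdDiff_iter ha.le (hF i (by omega)) j
    obtain ⟨ξ, hξ, hξ'⟩ := exists_hasDerivAt_eq_slope _ _ (show x < x + a by linarith)
      (fun y hy => (hd y (hx.trans hy.1)).continuousAt.continuousWithinAt)
      (fun y hy => hd y (hx.trans hy.1.le))
    have hb := ih (i + 1) (by omega) ξ (hx.trans hξ.1.le) (by linarith [hξ.2])
    rw [add_sub_cancel_left, eq_div_iff ha.ne'] at hξ'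
    rw [Function.iterate_succ_apply', fwdDiff, ← hξ', pow_succ]
    constructor <;> nlinarith [hb.1, hb.2]

lemma fwdDiff_iter_comp_progression (g : ℝ → ℝ) (a b : ℝ) (k n : ℕ) :
    (fwdDiff 1)^[k] (fun m : ℕ => g (a * m + b)) n = (fwdDiff a)^[k] g (a * n + b) := by
  induction k generalizing n with
  | zero => rfl
  | succ k ih =>
    rw [Function.iterate_succ_apply', Function.iterate_succ_apply', fwdDiff, fwdDiff, ih, ih,
      show a * ((n + 1 : ℕ) : ℝ) + b = a * n + b + a by push_cast; ring]

/-! ### Exponential sums along arithmetic progressions -/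

/-- The mean value theorem turns the bounds for the derivative into bounds for differences with step
`a`, which gain a factor `a^(k+2)`. Starting at `b ≥ N^(1-η)` makes the asymptotic bounds available
at every point used, uniformly in `a`, `b` and `h`. -/
theorem norm_sum_progression_le {f : ℝ → ℝ} {k : ℕ} {γ : ℝ} (h0 : 0 < γ) (h2 : γ < 2)
    (hd : ∀ j, ∀ᶠ x in atTop, DifferentiableAt ℝ (deriv^[j] f) x)
    (hsign : (∀ᶠ x in atTop, 0 < deriv^[k + 2] f x) ∨ ∀ᶠ x in atTop, deriv^[k + 2] f x < 0)
    (hb : ∀ ε : ℝ, 0 < ε → ∀ᶠ x in atTop,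
      x ^ (-γ - ε) ≤ |deriv^[k + 2] f x| ∧ |deriv^[k + 2] f x| ≤ x ^ (-γ + ε)) :
    ∃ η : ℝ, 0 < η ∧ η < 1 ∧ ∀ᶠ N : ℕ in atTop, ∀ (M a h : ℕ) (b : ℝ), M ≤ N → 1 ≤ a →
      (a : ℝ) ≤ (N : ℝ) ^ η → (N : ℝ) ^ (1 - η) ≤ b → a * (M + (k + 2 : ℕ)) + b ≤ (k + 4) * N →
      1 ≤ h → (h : ℝ) ≤ (N : ℝ) ^ η →
      ‖∑ m ∈ Finset.range M, expTwoPi (h * f (a * m + b))‖ ≤ (N : ℝ) ^ (1 - η) := by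
  obtain ⟨η₀, hη₀, hS⟩ := norm_sum_le_of_difference_bounds h0 h2 k
  set ε := min γ η₀ / 2 with hε
  have hε0 : 0 < ε := by have : 0 < min γ η₀ := lt_min h0 hη₀
                         positivity
  have hεγ : ε < γ := by have := min_le_left γ η₀; linarith
  have hεη : ε ≤ η₀ / 2 := by have := min_le_right γ η₀; linarith
  -- The upper bound loses `N^(η(k+2))` from the step, `N^η` from `h` and at most `N^(2η)` from
  -- arguments as small as `N^(1-η)`. Together with `ε ≤ η₀/2` this stays within `N^(η₀)`.
  set η := min (min η₀ 1 / 2) (η₀ / (2 * (k + 6))) with hη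
  have hη0 : 0 < η := by
    have : 0 < min η₀ 1 := lt_min hη₀ one_pos
    exact lt_min (by positivity) (by positivity)
  have hη1 : η < 1 := by
    have e1 := min_le_left (min η₀ 1 / 2) (η₀ / (2 * (k + 6)))
    have e2 := min_le_right η₀ 1
    linarith
  have hηη : η ≤ η₀ := by
    have e1 := min_le_left (min η₀ 1 / 2) (η₀ / (2 * (k + 6)))
    have e2 := min_le_left η₀ 1
    linarith
  have hηk : η * (k + 6) ≤ η₀ / 2 := by
    have e1 := min_le_right (min η₀ 1 / 2) (η₀ / (2 * (k + 6)))
    calc η * (k + 6) ≤ η₀ / (2 * (k + 6)) * (k + 6) := by gcongr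
      _ = η₀ / 2 := by field_simp
  refine ⟨η, hη0, hη1, ?_⟩
  -- Changing the sign of `f` conjugates the exponential sum, so the derivative may be taken
  -- positive.
  obtain ⟨s, hs, hspos⟩ : ∃ s : ℝ, (s = 1 ∨ s = -1) ∧
      ∀ᶠ x in atTop, s * deriv^[k + 2] f x = |deriv^[k + 2] f x| := by
    rcases hsign with h | h
    · exact ⟨1, Or.inl rfl, h.mono fun x hx => by rw [abs_of_pos hx, one_mul]⟩
    · exact ⟨-1, Or.inr rfl, h.mono fun x hx => by rw [abs_of_neg hx, neg_one_mul]⟩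
  obtain ⟨X, hX⟩ := eventually_atTop.1 (((Finset.eventually_all (Finset.range (k + 2))).2
    fun j _ => hd j).and (hspos.and (hb ε hε0)))
  have htend : Tendsto (fun N : ℕ => (N : ℝ) ^ (1 - η)) atTop atTop :=
    (tendsto_rpow_atTop (sub_pos.2 hη1)).comp tendsto_natCast_atTop_atTop
  filter_upwards [hS, htend.eventually_ge_atTop X, eventually_ge_atTop 1,
    eventually_natCast_mul_rpow_le (((k : ℝ) + 4) ^ (γ + ε)) (a := -γ - η₀) (b := -γ - ε)
      (by linarith)] with N hSN hXN hN hlowN M a h b hM ha haN hbN habN hh hhN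
  have hNpos : (0 : ℝ) < N := by exact_mod_cast hN
  have hN1 : (1 : ℝ) ≤ N := by exact_mod_cast hN
  have ha1 : (1 : ℝ) ≤ a := by exact_mod_cast ha
  have hh1 : (1 : ℝ) ≤ h := by exact_mod_cast hh
  have hNη : 0 < (N : ℝ) ^ (1 - η) := by positivity
  have hsum : ‖∑ m ∈ Finset.range M, expTwoPi (h * f (a * m + b))‖ =
      ‖∑ m ∈ Finset.range M, expTwoPi (s * h * f (a * m + b))‖ := by
    rcases hs with rfl | rfl
    · simp
    · rw [← norm_sum_expTwoPi_neg]; simp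
  rw [hsum]
  refine (hSN M (fun m => s * h * f (a * m + b)) hM fun n hn => ?_).trans
    (Real.rpow_le_rpow_of_exponent_le hN1 (by linarith))
  rw [fwdDiff_iter_comp_progression (fun x => s * h * f x)]
  have hder : ∀ i < k + 2, ∀ x, (N : ℝ) ^ (1 - η) ≤ x →
      HasDerivAt (fun x => s * h * deriv^[i] f x) (s * h * deriv^[i + 1] f x) x := by
    intro i hi x hx
    have := ((hX x (hXN.trans hx)).1 i (Finset.mem_range.2 hi)).hasDerivAt.const_mul (s * h)
    rwa [← Function.iterate_succ_apply' deriv i f] at this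
  have hbound : ∀ x, (N : ℝ) ^ (1 - η) ≤ x → x ≤ (k + 4) * N →
      (N : ℝ) ^ (-γ - η₀) ≤ s * h * deriv^[k + 2] f x ∧
      s * h * deriv^[k + 2] f x ≤ (N : ℝ) ^ (η + (1 - η) * (-γ + ε)) := by
    intro x hx hx1
    have hx0 : 0 < x := hNη.trans_le hx
    obtain ⟨-, e1, e2, e3⟩ := hX x (hXN.trans hx)
    rw [mul_right_comm, e1]
    constructor
    · calc (N : ℝ) ^ (-γ - η₀) ≤ ((k : ℝ) + 4) ^ (-γ - ε) * (N : ℝ) ^ (-γ - ε) := by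
            rw [show -γ - ε = -(γ + ε) by ring, Real.rpow_neg (by positivity) (γ + ε),
              le_inv_mul_iff₀ (by positivity)]
            rwa [show -(γ + ε) = -γ - ε by ring]
        _ = ((k + 4) * (N : ℝ)) ^ (-γ - ε) := by
            rw [Real.mul_rpow (by positivity) hNpos.le]
        _ ≤ x ^ (-γ - ε) := Real.rpow_le_rpow_of_nonpos hx0 hx1 (by linarith)
        _ ≤ |deriv^[k + 2] f x| := e2
        _ ≤ |deriv^[k + 2] f x| * h := le_mul_of_one_le_right (abs_nonneg _) hh1
    · calc |deriv^[k + 2] f x| * h ≤ x ^ (-γ + ε) * (N : ℝ) ^ η := by gcongr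
        _ ≤ ((N : ℝ) ^ (1 - η)) ^ (-γ + ε) * (N : ℝ) ^ η := by
            gcongr ?_ * _
            exact Real.rpow_le_rpow_of_nonpos hNη hx (by linarith)
        _ = (N : ℝ) ^ (η + (1 - η) * (-γ + ε)) := by
            rw [← Real.rpow_mul hNpos.le, ← Real.rpow_add hNpos, add_comm]
  have hn' : (n : ℝ) ≤ M := by exact_mod_cast hn.le
  have key := fwdDiff_iter_mem_Icc (F := fun i x => s * h * deriv^[i] f x) (a := a)
    (by linarith) hder hbound (k + 2) 0 (zero_add _) (a * n + b)
    (hbN.trans (le_add_of_nonneg_left (by positivity)))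
    (by refine le_trans ?_ habN
        have : (a : ℝ) * n ≤ a * M := by gcongr
        linarith)
  have hpow1 : 1 ≤ (a : ℝ) ^ (k + 2) := one_le_pow₀ ha1
  refine ⟨(le_mul_of_one_le_left (by positivity) hpow1).trans key.1, key.2.trans ?_⟩
  calc (a : ℝ) ^ (k + 2) * (N : ℝ) ^ (η + (1 - η) * (-γ + ε))
      ≤ ((N : ℝ) ^ η) ^ (k + 2) * (N : ℝ) ^ (η + (1 - η) * (-γ + ε)) := by gcongr
    _ = (N : ℝ) ^ (η * (k + 2 : ℕ) + (η + (1 - η) * (-γ + ε))) := by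
        rw [← Real.rpow_natCast, ← Real.rpow_mul hNpos.le, ← Real.rpow_add hNpos]
    _ ≤ (N : ℝ) ^ (-γ + η₀) := by
        refine Real.rpow_le_rpow_of_exponent_le hN1 ?_
        push_cast
        nlinarith

/-! ### The well-distribution measure -/

lemma abs_chi (x : ℝ) : |(chi x : ℝ)| = 1 := by
  rw [chi]; split_ifs <;> simp

lemma natAbs_chi (x : ℝ) : (chi x).natAbs = 1 := by
  rw [chi]; split_ifs <;> simp

lemma progSum_binarySeq (f : ℝ → ℝ) {M a : ℕ} {b : ℤ} (ha : 1 ≤ a) (hab : 1 ≤ (a : ℤ) + b) :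
    (progSum (binarySeq f) M a b : ℝ) =
      ∑ n ∈ Finset.range M, (chi (f (a * (n + 1 : ℕ) + b)) : ℝ) := by
  rw [progSum, Finset.range_eq_Ico, Finset.sum_Ico_add' (fun n : ℕ => (chi (f (a * n + b)) : ℝ)),
    Int.cast_sum]
  refine Finset.sum_congr (by ext; simp) fun n hn => ?_
  rw [Finset.mem_Ico] at hn
  have h0 : 0 ≤ (a : ℤ) * n + b := by
    have : (a : ℤ) * 1 ≤ a * n := by gcongr; omega
    linarith
  rw [binarySeq]
  congr 3
  have : ((((a : ℤ) * n + b).toNat : ℤ) : ℝ) = (((a : ℤ) * n + b : ℤ) : ℝ) := by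
    rw [Int.toNat_of_nonneg h0]
  push_cast at this
  exact this

/-- Progressions with step above `N^η` have at most `N^(1-η) + 1` terms. In the others the first
`N^(1-η)` or so terms are discarded, and the rest is treated by the Erdős–Turán type inequality. -/
theorem exists_wellDistribution_le {f : ℝ → ℝ} {k : ℕ} {γ : ℝ} (h0 : 0 < γ) (h2 : γ < 2)
    (hd : ∀ j, ∀ᶠ x in atTop, DifferentiableAt ℝ (deriv^[j] f) x)
    (hsign : (∀ᶠ x in atTop, 0 < deriv^[k + 2] f x) ∨ ∀ᶠ x in atTop, deriv^[k + 2] f x < 0)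
    (hb : ∀ ε : ℝ, 0 < ε → ∀ᶠ x in atTop,
      x ^ (-γ - ε) ≤ |deriv^[k + 2] f x| ∧ |deriv^[k + 2] f x| ≤ x ^ (-γ + ε)) :
    ∃ σ C : ℝ, 0 < σ ∧ σ < 1 ∧ ∀ᶠ N : ℕ in atTop,
      (wellDistribution (binarySeq f) N : ℝ) ≤ C * (N : ℝ) ^ (1 - σ) := by
  obtain ⟨η, hη0, hη1, hS⟩ := norm_sum_progression_le h0 h2 hd hsign hb
  obtain ⟨C, hC, hchi⟩ := abs_sum_chi_le
  refine ⟨η / 8, 2 + 4 * C, by positivity, by linarith, ?_⟩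
  filter_upwards [hS, eventually_ge_atTop 1] with N hSN hN
  have hNpos : (0 : ℝ) < N := by exact_mod_cast hN
  have hN1 : (1 : ℝ) ≤ N := by exact_mod_cast hN
  have hle : ∀ {x y : ℝ}, x ≤ y → (N : ℝ) ^ x ≤ (N : ℝ) ^ y :=
    fun h => Real.rpow_le_rpow_of_exponent_le hN1 h
  obtain ⟨a, M, b, ha, hM, hab, -, haMb, hw⟩ :=
    (isGreatest_wellDistribution (binarySeq f) (fun n => natAbs_chi _) hN).1
  have hval : (wellDistribution (binarySeq f) N : ℝ) =
      |∑ n ∈ Finset.range M, (chi (f (a * (n + 1 : ℕ) + b)) : ℝ)| := by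
    rw [← progSum_binarySeq f ha hab, hw, Nat.cast_natAbs, Int.cast_abs]
  rw [hval]
  have ha1 : (1 : ℝ) ≤ a := by exact_mod_cast ha
  have hM1 : (1 : ℝ) ≤ M := by exact_mod_cast hM
  have hab' : (1 : ℝ) ≤ a + b := by exact_mod_cast hab
  have haMb' : (a : ℝ) * M + b ≤ N := by exact_mod_cast haMb
  have hMN : (M : ℝ) ≤ N := by nlinarith
  have hone : 1 ≤ (N : ℝ) ^ (1 - η) := Real.one_le_rpow hN1 (by linarith)
  have hη8 : (N : ℝ) ^ (1 - η) ≤ (N : ℝ) ^ (1 - η / 8) := hle (by linarith)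
  have htriv : ∀ (m : ℕ) (g : ℕ → ℝ), |∑ n ∈ Finset.range m, (chi (g n) : ℝ)| ≤ m := by
    intro m g
    refine (Finset.abs_sum_le_sum_abs _ _).trans ?_
    simp [abs_chi]
  have hfinal : ∀ x : ℝ, x ≤ 2 * (N : ℝ) ^ (1 - η) → x ≤ (2 + 4 * C) * (N : ℝ) ^ (1 - η / 8) := by
    intro x hx
    have : 0 ≤ 4 * C * (N : ℝ) ^ (1 - η / 8) := by positivity
    linarith
  rcases lt_or_ge ((N : ℝ) ^ η) a with haN | haN
  · refine hfinal _ ((htriv M fun n => f (a * (n + 1 : ℕ) + b)).trans ?_)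
    have h3 : (M - 1 : ℝ) * (N : ℝ) ^ η ≤ (N : ℝ) ^ (1 - η) * (N : ℝ) ^ η := by
      rw [← Real.rpow_add hNpos, sub_add_cancel, Real.rpow_one]
      nlinarith
    have := le_of_mul_le_mul_right h3 (by positivity)
    linarith
  set T := ⌈(N : ℝ) ^ (1 - η)⌉₊ with hT
  have hT1 : (N : ℝ) ^ (1 - η) ≤ T := Nat.le_ceil _
  have hT2 : (T : ℝ) ≤ 2 * (N : ℝ) ^ (1 - η) := by
    have := Nat.ceil_lt_add_one (show 0 ≤ (N : ℝ) ^ (1 - η) by positivity)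
    linarith
  rcases le_or_gt M T with hMT | hMT
  · exact hfinal _ ((htriv M fun n => f (a * (n + 1 : ℕ) + b)).trans
      ((by exact_mod_cast hMT : (M : ℝ) ≤ T).trans hT2))
  obtain ⟨M', rfl⟩ := Nat.exists_eq_add_of_lt hMT
  rw [add_assoc] at *
  set R := M' + 1 with hR
  rw [Finset.sum_range_add]
  have hRN : R ≤ N := by
    have : ((T + R : ℕ) : ℝ) ≤ N := hMN
    have : T + R ≤ N := by exact_mod_cast this
    omega
  -- The offset after dropping `T` terms. Although `b` may be negative, `a + b ≥ 1` gives `b' ≥ T`.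
  set b' : ℝ := a * (T + 1) + b with hb'
  have hb'T : (N : ℝ) ^ (1 - η) ≤ b' := by
    have : (T : ℝ) ≤ a * T := le_mul_of_one_le_left (by positivity) ha1
    rw [hb']; linarith
  have haN' : (a : ℝ) ≤ N := haN.trans ((hle hη1.le).trans_eq (Real.rpow_one _))
  -- Differences of order `k + 2` look beyond the last term; the overshoot, together with the index
  -- shift in `b'`, is `a (k + 3) ≤ (k + 3) N`.
  have hup : (a : ℝ) * (R + (k + 2 : ℕ)) + b' ≤ (k + 4) * N := by
    have : (a : ℝ) * (k + 3) ≤ N * (k + 3) := by gcongr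
    push_cast at haMb' ⊢
    rw [hb']
    linarith
  set Q := ⌊(N : ℝ) ^ η⌋₊ with hQ
  have hNη : 1 ≤ (N : ℝ) ^ η := Real.one_le_rpow hN1 hη0.le
  have hQ1 : 1 ≤ Q := Nat.le_floor (by simpa using hNη)
  have hQ1' : (1 : ℝ) ≤ Q := by exact_mod_cast hQ1
  have hQ2 : (N : ℝ) ^ η ≤ 4 * Q := by
    have := Nat.lt_floor_add_one ((N : ℝ) ^ η)
    linarith
  -- With `δ = N^(-η/8)`, dividing by `δ` costs only `N^(η/8)` of the savings `N^η` and `N^(η/2)`,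
  -- while the term with the factor `δ` saves `N^(η/8)`.
  have hmain := hchi (Finset.range R) (fun m => f (a * m + b')) Q ((N : ℝ) ^ (1 - η))
    ((N : ℝ) ^ (-(η / 8))) hQ1 (by positivity) fun h hh1 hhQ =>
      hSN R a h b' hRN ha haN hb'T hup hh1 ((Nat.cast_le.2 hhQ).trans (Nat.floor_le (by positivity)))
  rw [Finset.card_range] at hmain
  have hRN' : (R : ℝ) ≤ N := by exact_mod_cast hRN
  have hsqrt : (R : ℝ) / Real.sqrt Q ≤ 2 * (N : ℝ) ^ (1 - η / 2) := by
    have h1 : (N : ℝ) ^ (η / 2) ≤ 2 * Real.sqrt Q := by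
      have : Real.sqrt ((N : ℝ) ^ η) ≤ Real.sqrt (4 * Q) := Real.sqrt_le_sqrt hQ2
      rw [Real.sqrt_mul (by norm_num), show (4 : ℝ) = 2 ^ 2 by norm_num,
        Real.sqrt_sq (by norm_num), Real.sqrt_eq_rpow, ← Real.rpow_mul hNpos.le] at this
      rwa [div_eq_mul_one_div]
    rw [div_le_iff₀ (by positivity)]
    calc (R : ℝ) ≤ N := hRN'
      _ = (N : ℝ) ^ (1 - η / 2) * (N : ℝ) ^ (η / 2) := by
        rw [← Real.rpow_add hNpos, sub_add_cancel, Real.rpow_one]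
      _ ≤ (N : ℝ) ^ (1 - η / 2) * (2 * Real.sqrt Q) := by gcongr
      _ = _ := by ring
  have hbig : |∑ m ∈ Finset.range R, (chi (f (a * m + b')) : ℝ)| ≤
      4 * C * (N : ℝ) ^ (1 - η / 8) := by
    refine hmain.trans ?_
    rw [show 4 * C * (N : ℝ) ^ (1 - η / 8) = C * (4 * (N : ℝ) ^ (1 - η / 8)) by ring]
    gcongr
    rw [Real.rpow_neg hNpos.le, div_inv_eq_mul]
    have e1 : (N : ℝ) ^ (1 - η) * (N : ℝ) ^ (η / 8) ≤ (N : ℝ) ^ (1 - η / 8) := by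
      rw [← Real.rpow_add hNpos]; exact hle (by linarith)
    have e2 : (N : ℝ) ^ (1 - η / 2) * (N : ℝ) ^ (η / 8) ≤ (N : ℝ) ^ (1 - η / 8) := by
      rw [← Real.rpow_add hNpos]; exact hle (by linarith)
    have e3 : (R : ℝ) * ((N : ℝ) ^ (η / 8))⁻¹ ≤ (N : ℝ) ^ (1 - η / 8) := by
      rw [Real.rpow_sub hNpos, Real.rpow_one, ← div_eq_mul_inv]; gcongr
    have e4 : (R : ℝ) / Real.sqrt Q * (N : ℝ) ^ (η / 8) ≤
        2 * (N : ℝ) ^ (1 - η / 2) * (N : ℝ) ^ (η / 8) := by gcongr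
    linarith
  refine (abs_add_le _ _).trans ?_
  have hfirst := htriv T fun n => f (a * (n + 1 : ℕ) + b)
  have heq : ∑ x ∈ Finset.range R, (chi (f (a * (T + x + 1 : ℕ) + b)) : ℝ) =
      ∑ m ∈ Finset.range R, (chi (f (a * m + b')) : ℝ) := by
    refine Finset.sum_congr rfl fun m _ => ?_
    rw [show (a : ℝ) * (T + m + 1 : ℕ) + b = a * m + b' by rw [hb']; push_cast; ring]
  rw [heq]
  linarith

end HardyWD

/-! ### From large `N` to all `N` -/

theorem theorem1 (ℓ : ℕ) (f : ℝ → ℝ)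
    (hf : (f : HardyWD.GermRing) ∈ HardyWD.hardyUnion)
    (htype : HardyWD.IsOfType f ℓ) :
    ∃ σ : ℝ, 0 < σ ∧ ∀ ε : ℝ, 0 < ε → ∃ C : ℝ, ∀ N : ℕ, 1 ≤ N →
      (HardyWD.wellDistribution (HardyWD.binarySeq f) N : ℝ) ≤ C * (N : ℝ) ^ (1 - σ + ε) := by
  obtain ⟨k, γ, h0, h2, hd, hsign, hb⟩ := HardyWD.exists_iterate_deriv_bounds hf htype
  obtain ⟨σ, C, hσ, hσ1, hW⟩ := HardyWD.exists_wellDistribution_le h0 h2 hd hsign hb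
  obtain ⟨N₀, hN₀⟩ := eventually_atTop.1 hW
  refine ⟨σ, hσ, fun ε hε => ?_⟩
  -- The sum absorbs the finitely many `N < N₀`, where the power of `N` is at least 1.
  refine ⟨|C| + ∑ n ∈ Finset.range N₀,
    (HardyWD.wellDistribution (HardyWD.binarySeq f) n : ℝ), fun N hN => ?_⟩
  have hN1 : (1 : ℝ) ≤ N := by exact_mod_cast hN
  have hle : (N : ℝ) ^ (1 - σ) ≤ (N : ℝ) ^ (1 - σ + ε) :=
    Real.rpow_le_rpow_of_exponent_le hN1 (by linarith)
  have hone : 1 ≤ (N : ℝ) ^ (1 - σ + ε) := Real.one_le_rpow hN1 (by linarith)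
  have hsum : 0 ≤ ∑ n ∈ Finset.range N₀,
      (HardyWD.wellDistribution (HardyWD.binarySeq f) n : ℝ) :=
    Finset.sum_nonneg fun _ _ => Nat.cast_nonneg _
  rw [add_mul]
  rcases le_or_gt N₀ N with h | h
  · calc _ ≤ C * (N : ℝ) ^ (1 - σ) := hN₀ N h
      _ ≤ |C| * (N : ℝ) ^ (1 - σ + ε) := by gcongr; exact le_abs_self C
      _ ≤ _ := le_add_of_nonneg_right (by positivity)
  · calc _ ≤ ∑ n ∈ Finset.range N₀, (HardyWD.wellDistribution (HardyWD.binarySeq f) n : ℝ) :=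
        Finset.single_le_sum (f := fun n =>
          (HardyWD.wellDistribution (HardyWD.binarySeq f) n : ℝ))
          (fun _ _ => Nat.cast_nonneg _) (Finset.mem_range.2 h)
      _ ≤ _ := le_mul_of_one_le_right hsum hone
      _ ≤ _ := le_add_of_nonneg_left (by positivity)
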